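/- Let $q\ge 0$ be an integer and let $(G_n)$ be a sequence of finite simple vertex-transitive $(q+1)$-regular graphs with $|V(G_n)|\to\infty$; fix a vertex $x_n$ of each $G_n$. Let $a\in[0,1]$, $b\in\mathbb R$, $\eta=(1-q)a+b(q+1)$, $\sigma=b((1-q)a+bq)$. For a graph $G$ with a fixed vertex $x_0$ the generalized $(a,b)$-zeta function is $$\zeta_{a,b}(G,u)=\exp\Big(\sum_{r\ge1}\frac{N_r^0}{r}u^r\Big),\qquad N_r^0=\sum_{C} w(e_1,e_2)\cdots w(e_{r-1},e_r)\,w(e_r,e_1),$$ where $C=(e_1,\dots,e_r)$ runs over all closed paths of $r$ arcs (oriented edges) starting and ending at $x_0$, backtracking allowed, and $w(f,e)=\big(\tfrac{2}{\deg t(f)}-1\big)a$ if $f=e^{-1}$, $w(f,e)=\big(\tfrac{2}{\deg t(f)}-1\big)a+b$ if $t(f)=o(e)$ and $f\ne e^{-1}$, and $w(f,e)=0$ otherwise ($o(e)$, $t(e)$ are the origin and terminus of the arc $e$). For a $(q+1)$-regular graph $G$, finite or infinite, let $P=\frac1{q+1}A$ and $\Delta=(q+1)I-A$ be the transition operator of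 the simple random walk and the Laplacian on $\ell^2(V(G))$, where $A$ is the adjacency operator. The spectral measure of such an operator $T$ at a vertex $x$ is the measure $\mu$ on $\mathbb R$ with $\int f\,d\mu=\langle\delta_x,f(T)\delta_x\rangle$ for all compactly supported continuous $f$ (for a finite vertex-transitive graph it is the normalized counting measure of the eigenvalues). Let $u\in\mathbb C$ with $|u|\,|b|<1$ and $|u|\,|(1-q)a+bq|<1$; all logarithms and powers below are principal. Then the series defining $\zeta_{a,b}(G_n,u)$ (with $x_0=x_n$) converges for every $n$, and: 1. If $\mu_P$ is a probability measure that is the weak limit of the spectral measures of $P(G_n)$ at $x_n$, then the integrand below is $\mu_P$-integrable and $$\lim_{n\to\infty}\zeta_{a,b}(G_n,u)^{-1}=(1-b^2u^2)^{(q-1)/2}\exp\Big[\int\log\{(1+\sigma u^2)-\eta u\lambda\}\,d\mu_P(\lambda)\Big].$$ 2. If $\mu_\Delta$ is a probability measure that is the weak limit of the spectral measures of $\Delta(G_n)$ at $x_n$, then the integrand below is $\mu_\Delta$-integrable and $$\lim_{n\to\infty}\zeta_{a,b}(G_n,u)^{-1}=(1-b^2u^2)^{(q-1)/2}\exp\Big[\int\log\Big\{(1-\eta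 u+\sigma u^2)+\frac{\eta u}{q+1}\lambda\Big\}\,d\mu_\Delta(\lambda)\Big].$$ 3. If the rooted graphs $(G_n,x_n)$ converge locally to a $(q+1)$-regular rooted graph $(H,o)$ (for each $r$, the balls of radius $r$ around the roots are isomorphic as rooted graphs for all large $n$), then the spectral measures of $P(H)$ and of $\Delta(H)$ at $o$ are probability measures and are the weak limits $\mu_P$ and $\mu_\Delta$ required in 1 and 2. -/

import Mathlib

open Filter Topology MeasureTheory

noncomputable section

namespace GroverZeta

/-! ### The generalized `(a, b)`-zeta function -/

section Zeta

variable {V : Type*} (G : SimpleGraph V)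

/-- A graph is vertex-transitive if its automorphisms act transitively on the vertices. -/
def IsVertexTransitive : Prop :=
  ∀ x y : V, ∃ φ : G ≃g G, φ x = y

/-- A sequence of arcs `c 0, …, c (r - 1)` is an `x₀`-cycle of length `r`: it starts at `x₀`, each
arc ends where the next one starts, and the last arc ends where the first one starts (the
addition of `Fin r` is cyclic). Backtracking is allowed. -/
def IsCycleAt (x₀ : V) {r : ℕ} [NeZero r] (c : Fin r → G.Dart) : Prop :=
  (c 0).fst = x₀ ∧ ∀ i, (c i).snd = (c (i + 1)).fst

variable [G.LocallyFinite]

open Classical in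
/-- The weight `w(f, e)`, which is the entry `(e, f)` of the generalized Grover matrix. -/
def arcWeight (a b : ℝ) (f e : G.Dart) : ℝ :=
  if f = e.symm then (2 / (G.degree f.snd : ℝ) - 1) * a
  else if f.snd = e.fst then (2 / (G.degree f.snd : ℝ) - 1) * a + b
  else 0

/-- The weight `w(C) = w(e₁, e₂) ⋯ w(e_{r-1}, e_r) w(e_r, e₁)` of a cycle. -/
def cycleWeight (a b : ℝ) {r : ℕ} [NeZero r] (c : Fin r → G.Dart) : ℝ :=
  ∏ i, arcWeight G a b (c i) (c (i + 1))

/-- `N⁰_r`, the sum of the weights of all `x₀`-cycles of length `r`. In a locally finite graph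
there are finitely many of them. -/
def cycleSum (a b : ℝ) (x₀ : V) (r : ℕ) [NeZero r] : ℝ :=
  ∑ᶠ c ∈ {c : Fin r → G.Dart | IsCycleAt G x₀ c}, cycleWeight G a b c

/-- The term of index `r = k + 1` of the series `∑_{r ≥ 1} (N⁰_r / r) u ^ r`. -/
def zetaTerm (a b : ℝ) (x₀ : V) (u : ℂ) (k : ℕ) : ℂ :=
  (cycleSum G a b x₀ (k + 1) : ℂ) / ((k + 1 : ℕ) : ℂ) * u ^ (k + 1)

/-- The generalized `(a, b)`-zeta function `ζ_{a,b}(G, u) = exp (∑_{r ≥ 1} (N⁰_r / r) u ^ r)`. -/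
def zeta (a b : ℝ) (x₀ : V) (u : ℂ) : ℂ :=
  Complex.exp (∑' k : ℕ, zetaTerm G a b x₀ u k)

end Zeta

/-! ### The transition operator and the Laplacian of a regular graph -/

section Operators

variable {V : Type*} {G : SimpleGraph V} [G.LocallyFinite] {d : ℕ}

theorem sum_norm_sq_le (h : G.IsRegularOfDegree d) (f : lp (fun _ : V => ℂ) 2) (s : Finset V) :
    ∑ v ∈ s, ‖∑ w ∈ G.neighborFinset v, f w‖ ^ (2 : ENNReal).toReal
      ≤ ((d : ℝ) * ‖f‖) ^ (2 : ENNReal).toReal := by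
  classical
  have h2 : (2 : ENNReal).toReal = ((2 : ℕ) : ℝ) := by norm_num
  have hf := lp.sum_rpow_le_norm_rpow (p := 2) (by norm_num) f
  simp only [h2, Real.rpow_natCast] at hf ⊢
  have h1 : ∀ v, ‖∑ w ∈ G.neighborFinset v, f w‖ ^ 2
      ≤ d * ∑ w ∈ G.neighborFinset v, ‖f w‖ ^ 2 := fun v => by
    calc ‖∑ w ∈ G.neighborFinset v, f w‖ ^ 2
        ≤ (∑ w ∈ G.neighborFinset v, ‖f w‖) ^ 2 := by
          gcongr
          exact norm_sum_le _ _
      _ ≤ ((G.neighborFinset v).card : ℝ) * ∑ w ∈ G.neighborFinset v, ‖f w‖ ^ 2 :=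
          sq_sum_le_card_mul_sum_sq
      _ = _ := by rw [G.card_neighborFinset_eq_degree, h v]
  calc ∑ v ∈ s, ‖∑ w ∈ G.neighborFinset v, f w‖ ^ 2
      ≤ ∑ v ∈ s, (d : ℝ) * ∑ w ∈ G.neighborFinset v, ‖f w‖ ^ 2 :=
        Finset.sum_le_sum fun v _ => h1 v
    _ = d * ∑ v ∈ s, ∑ w ∈ G.neighborFinset v, ‖f w‖ ^ 2 := by rw [Finset.mul_sum]
    _ = d * ∑ w ∈ s.biUnion (fun v => G.neighborFinset v),
          ∑ _v ∈ s ∩ G.neighborFinset w, ‖f w‖ ^ 2 := by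
        congr 1
        refine Finset.sum_comm' fun v w => ?_
        simp only [Finset.mem_inter, SimpleGraph.mem_neighborFinset, Finset.mem_biUnion]
        exact ⟨fun ⟨hv, hw⟩ => ⟨⟨hv, hw.symm⟩, v, hv, hw⟩, fun ⟨⟨hv, hw⟩, _⟩ => ⟨hv, hw.symm⟩⟩
    _ ≤ d * ∑ w ∈ s.biUnion (fun v => G.neighborFinset v), d * ‖f w‖ ^ 2 := by
        gcongr with w _
        rw [Finset.sum_const, nsmul_eq_mul]
        gcongr
        calc (s ∩ G.neighborFinset w).card ≤ (G.neighborFinset w).card :=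
              Finset.card_le_card Finset.inter_subset_right
          _ = d := by rw [G.card_neighborFinset_eq_degree, h w]
    _ ≤ d * (d * ‖f‖ ^ 2) := by
        rw [← Finset.mul_sum]
        gcongr
        exact hf _
    _ = (d * ‖f‖) ^ 2 := by ring

/-- The adjacency operator `(A f)(v) = ∑_{w ∼ v} f(w)` of a `d`-regular graph, finite or infinite,
as a bounded operator on `ℓ²(V)`. -/
def adjOp (h : G.IsRegularOfDegree d) :
    lp (fun _ : V => ℂ) 2 →L[ℂ] lp (fun _ : V => ℂ) 2 :=
  LinearMap.mkContinuous
    { toFun := fun f =>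
        ⟨fun v => ∑ w ∈ G.neighborFinset v, f w, memℓp_gen' (sum_norm_sq_le h f)⟩
      map_add' := fun f g => by
        ext v
        exact Finset.sum_add_distrib
      map_smul' := fun c f => by
        ext v
        simp [Finset.mul_sum] }
    d (fun f => lp.norm_le_of_forall_sum_le (by norm_num) (by positivity) (sum_norm_sq_le h f))

theorem adjOp_apply (h : G.IsRegularOfDegree d) (f : lp (fun _ : V => ℂ) 2) (v : V) :
    adjOp h f v = ∑ w ∈ G.neighborFinset v, f w := rfl

/-- The transition operator `(P f)(v) = ∑_{w ∼ v} f(w) / deg v` of the simple random walk on a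
`d`-regular graph. -/
def transitionOp (h : G.IsRegularOfDegree d) :
    lp (fun _ : V => ℂ) 2 →L[ℂ] lp (fun _ : V => ℂ) 2 :=
  (d : ℂ)⁻¹ • adjOp h

/-- The Laplacian `Δ = D - A` of a `d`-regular graph. -/
def laplacianOp (h : G.IsRegularOfDegree d) :
    lp (fun _ : V => ℂ) 2 →L[ℂ] lp (fun _ : V => ℂ) 2 :=
  (d : ℂ) • ContinuousLinearMap.id ℂ _ - adjOp h

open Classical in
/-- The unit vector `δ_x` of `ℓ²(V)`. -/
def delta (x : V) : lp (fun _ : V => ℂ) 2 := lp.single 2 x 1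

end Operators

/-! ### Spectral measures -/

section Spectral

variable {E : Type*} [NormedAddCommGroup E] [InnerProductSpace ℂ E] [CompleteSpace E]

/-- The positive functional `f ↦ ⟨x, f(T) x⟩` on the compactly supported continuous functions,
for a bounded self-adjoint operator `T`. -/
def spectralFunctional (T : E →L[ℂ] E) (x : E) :
    CompactlySupportedContinuousMap ℝ ℝ →ₚ[ℝ] ℝ :=
  PositiveLinearMap.mk₀
    { toFun := fun f => (inner ℂ x (cfc (fun t : ℝ => f t) T x)).re
      map_add' := fun f g => by
        have := cfc_add (a := T) (fun t : ℝ => f t) (fun t : ℝ => g t)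
          f.continuous.continuousOn g.continuous.continuousOn
        simp [this]
      map_smul' := fun c f => by
        have := cfc_const_mul (a := T) c (fun t : ℝ => f t) f.continuous.continuousOn
        simp [this, inner_smul_right_eq_smul] }
    (fun f hf => by
      have h : 0 ≤ cfc (fun t : ℝ => f t) T := cfc_nonneg fun t _ => hf t
      have := ((ContinuousLinearMap.nonneg_iff_isPositive _).1 h).re_inner_nonneg_right x
      simpa using this)

/-- The spectral measure of a bounded self-adjoint operator `T` at a vector `x`: the Borel measure
`μ` on `ℝ` that represents `f ↦ ⟨x, f(T) x⟩`, that is `∫ f dμ = ⟨x, f(T) x⟩`. -/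
def spectralMeasure (T : E →L[ℂ] E) (x : E) : Measure ℝ :=
  RealRMK.rieszMeasure (spectralFunctional T x)

end Spectral

/-- The spectral measure of the transition operator of a regular graph, at the vertex `x`. On a
vertex-transitive graph it does not depend on `x`; on a finite vertex-transitive graph it is the
normalized counting measure of the eigenvalues. -/
def transitionMeasure {V : Type*} {G : SimpleGraph V} [G.LocallyFinite] {d : ℕ}
    (h : G.IsRegularOfDegree d) (x : V) : Measure ℝ :=
  spectralMeasure (transitionOp h) (delta x)

/-- The spectral measure of the Laplacian of a regular graph, at the vertex `x`. -/
def laplacianMeasure {V : Type*} {G : SimpleGraph V} [G.LocallyFinite] {d : ℕ}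
    (h : G.IsRegularOfDegree d) (x : V) : Measure ℝ :=
  spectralMeasure (laplacianOp h) (delta x)

/-! ### Convergence -/

/-- Weak convergence of finite measures on `ℝ`. -/
def WeaklyConverges (μs : ℕ → Measure ℝ) (μ : Measure ℝ) : Prop :=
  ∀ f : BoundedContinuousFunction ℝ ℝ,
    Tendsto (fun n => ∫ t, f t ∂(μs n)) atTop (𝓝 (∫ t, f t ∂μ))

/-- Local convergence of rooted graphs: for each radius `r`, the balls of radius `r` around the
roots are eventually isomorphic as rooted graphs to the ball of radius `r` around the root of the
limit. -/
def LocallyConverges {V : ℕ → Type*} (G : ∀ n, SimpleGraph (V n)) (x : ∀ n, V n)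
    {W : Type*} (H : SimpleGraph W) (o : W) : Prop :=
  ∀ r : ℕ, ∀ᶠ n in atTop,
    ∃ e : (G n).induce ((G n).ball (x n) r) ≃g H.induce (H.ball o r),
      ∀ v, v.1 = x n → (e v).1 = o

end GroverZeta

end

namespace GroverZeta

open Polynomial Matrix

set_option linter.unusedSectionVars false

/-! ### Dickson polynomials -/

/-! Put `c = (1 - q) a + b q`, so that `η = b + c` and `σ = b c`. The matrix of arc weights is `W =
s T Oᵀ - b R`, where `O`, `T` are the origin and terminus incidence matrices, `R` reverses arcs and
`s (q + 1) = b + c`. On the span of the columns of `O` and `T` it is governed by `X² - s A X + σ`;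
on the orthogonal complement it is `-b R`, with eigenvalues `± b`. Hence `tr W ^ k = tr D_k(s A) +
(|E| / 2 - |V|) (b ^ k + (-b) ^ k)` with `|E|` the number of arcs and `D_k` the Dickson polynomial
for which `D_k(z + w) = z ^ k + w ^ k` when `z w = σ`. This is the Ihara–Bass formula in trace form
(`trace_grover_pow`).

By vertex-transitivity all vertices contribute equally to these traces, so `N⁰_k` is the integral of
`D_k(η λ)` against the spectral measure of `P`, plus `(q - 1) / 2 * (b ^ k + (-b) ^ k)`
(`cycleSum_eq_integral`). For `|λ| ≤ 1`, the numbers with sum `η λ` and product `σ` have modulus at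
most `max |b| |c|` (`norm_le_of_quadratic_root`). The bounds on `u` therefore make `∑ D_k(η λ) u ^ k
/ k` converge geometrically to `-log (1 - η u λ + σ u ^ 2)`, away from the branch cut. This yields
an exact formula for each finite graph (`zeta_inv_eq`), and its limit is weak convergence tested on
a function continuous on `[-1, 1]`.

The Laplacian is the affine image `(q + 1) (1 - P)`. Under local convergence each moment of `P`
depends only on a ball, so it is eventually constant, and Weierstrass approximation upgrades moments
to weak convergence. -/

theorem dickson_one_eq_sub_dickson_two {R : Type*} [CommRing R] (s : R) (k : ℕ) :
    dickson 1 s (k + 2) = dickson 2 s (k + 2) - C s * dickson 2 s k := by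
  induction k using Nat.strong_induction_on with
  | _ k ih =>
    match k with
    | 0 => simp [dickson_add_two]; ring
    | 1 => simp [dickson_add_two]; ring
    | k + 2 =>
      rw [dickson_add_two 1, ih (k + 1) (by omega), ih k (by omega)]
      have h1 := dickson_add_two 2 s (k + 2)
      have h2 := dickson_add_two 2 s (k + 1)
      have h3 := dickson_add_two 2 s k
      linear_combination -h1 + C s * h3

theorem dickson_one_eval_add {R : Type*} [CommRing R] (x y : R) (k : ℕ) :
    (dickson 1 (x * y) k).eval (x + y) = x ^ k + y ^ k := by
  induction k using Nat.strong_induction_on with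
  | _ k ih =>
    match k with
    | 0 => simp; norm_num
    | 1 => simp
    | k + 2 =>
      rw [dickson_add_two, eval_sub, eval_mul, eval_mul, ih (k + 1) (by omega), ih k (by omega)]
      simp only [eval_X, eval_C]
      ring

/-! ### The trace formula for the powers of a Grover-type matrix -/

section TraceFormula

variable {E V : Type*} [Fintype E] [Fintype V] [DecidableEq E] [DecidableEq V]
  {O T : Matrix E V ℝ} {R : Matrix E E ℝ} {A : Matrix V V ℝ} {d s b : ℝ}

/-- Together with the next identity: the columns of `O` and `T` span a subspace invariant under the
Grover-type matrix. -/
theorem grover_mul_origin (hRO : R * O = T) (hOO : Oᵀ * O = d • (1 : Matrix V V ℝ)) :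
    (s • (T * Oᵀ) - b • R) * O = (s * d - b) • T := by
  rw [Matrix.sub_mul, Matrix.smul_mul, Matrix.mul_assoc, hOO, Matrix.smul_mul, hRO,
    Matrix.mul_smul, Matrix.mul_one, smul_smul, sub_smul]

theorem grover_mul_terminus (hRT : R * T = O) (hOT : Oᵀ * T = A) :
    (s • (T * Oᵀ) - b • R) * T = T * (s • A) - b • O := by
  rw [Matrix.sub_mul, Matrix.smul_mul, Matrix.mul_assoc, hOT, Matrix.smul_mul, hRT,
    Matrix.mul_smul]

/-- Eliminating `O` from the two previous identities leaves a two-step recurrence with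
characteristic polynomial `X² - s A X + b (s d - b)`, which is that of the Dickson polynomials of
the second kind. -/
theorem grover_pow_mul_terminus (hRO : R * O = T) (hRT : R * T = O)
    (hOO : Oᵀ * O = d • (1 : Matrix V V ℝ)) (hOT : Oᵀ * T = A) (k : ℕ) :
    (s • (T * Oᵀ) - b • R) ^ (k + 1) * T =
      T * aeval (s • A) (dickson 2 (b * (s * d - b)) (k + 1))
        - b • (O * aeval (s • A) (dickson 2 (b * (s * d - b)) k)) := by
  induction k with
  | zero =>
    have h : (3 : ℝ[X]) - 2 = 1 := by norm_num
    simp [grover_mul_terminus hRT hOT, h]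
  | succ k ih =>
    rw [pow_succ', Matrix.mul_assoc, ih, Matrix.mul_sub, ← Matrix.mul_assoc,
      grover_mul_terminus hRT hOT, Matrix.mul_smul _ b, ← Matrix.mul_assoc,
      grover_mul_origin hRO hOO, dickson_add_two 2 _ k]
    simp only [map_sub, map_mul, aeval_X, aeval_C, Algebra.algebraMap_eq_smul_one,
      Matrix.smul_mul, Matrix.mul_smul, Matrix.one_mul, Matrix.sub_mul, Matrix.mul_sub, smul_smul,
      Matrix.mul_assoc]
    module

/-- The difference of the two traces satisfies `δ (k + 2) = b ^ 2 * δ k`, with `δ 0 = |E| - 2 |V|`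
and `δ 1 = 0`. This avoids any eigenspace decomposition, and with it the degenerate case where the
columns of `O` and `T` are dependent. -/
theorem trace_grover_pow (hRO : R * O = T) (hRR : R * R = 1)
    (hOO : Oᵀ * O = d • (1 : Matrix V V ℝ)) (hOT : Oᵀ * T = A)
    (hA : A.trace = 0) (hR : R.trace = 0) (k : ℕ) :
    ((s • (T * Oᵀ) - b • R) ^ k).trace =
      (aeval (s • A) (dickson 1 (b * (s * d - b)) k)).trace
        + ((Fintype.card E : ℝ) / 2 - Fintype.card V) * (b ^ k + (-b) ^ k) := by
  have hRT : R * T = O := by rw [← hRO, ← Matrix.mul_assoc, hRR, Matrix.one_mul]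
  set W := s • (T * Oᵀ) - b • R with hW
  set σ := b * (s * d - b) with hσ
  have h32 : (3 : ℝ[X]) - 2 = 1 := by norm_num
  have h31 : (3 : ℝ[X]) - 1 = C 2 := by rw [map_ofNat]; norm_num
  have hpow := grover_pow_mul_terminus (s := s) (b := b) hRO hRT hOO hOT
  rw [← hW, ← hσ] at hpow
  have hWO : W * O = (s * d - b) • T := grover_mul_origin hRO hOO
  have hRW : R * W = s • (O * Oᵀ) - b • 1 := by
    rw [hW, Matrix.mul_sub, Matrix.mul_smul, Matrix.mul_smul, hRR, ← Matrix.mul_assoc, hRT]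
  set t : ℕ → ℝ := fun k => (W ^ k).trace with ht
  set x : ℕ → ℝ := fun k => (aeval (s • A) (dickson 2 σ k)).trace with hx
  set y : ℕ → ℝ := fun k => (A * aeval (s • A) (dickson 2 σ k)).trace with hy
  set D : ℕ → ℝ := fun k => (aeval (s • A) (dickson 1 σ k)).trace with hD
  have hxy : ∀ k, s * y (k + 1) = x (k + 2) + σ * x k := fun k => by
    simp only [hx, hy, dickson_add_two]
    simp [Algebra.algebraMap_eq_smul_one, Matrix.trace_sub, Matrix.trace_smul]
  have hDx : ∀ k, D (k + 2) = x (k + 2) - σ * x k := fun k => by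
    simp only [hx, hD, dickson_one_eq_sub_dickson_two]
    simp [Algebra.algebraMap_eq_smul_one, Matrix.trace_sub, Matrix.trace_smul]
  have hx0 : x 0 = Fintype.card V := by simp [hx, h32]
  have hx1 : x 1 = 0 := by simp [hx, Matrix.trace_smul, hA]
  have hD0 : D 0 = 2 * Fintype.card V := by
    simp [hD, h31, Algebra.algebraMap_eq_smul_one, Matrix.trace_smul]
  have hD1 : D 1 = 0 := by simp [hD, Matrix.trace_smul, hA]
  have ht0 : t 0 = Fintype.card E := by simp [ht]
  have ht1 : t 1 = 0 := by
    simp [ht, hW, Matrix.trace_sub, Matrix.trace_smul, hR, Matrix.trace_mul_comm T, hOT, hA]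
  -- One factor `W` is expanded by its definition; in the reversal term a second one is absorbed
  -- through `R W = s O Oᵀ - b`, which produces `b ^ 2 * t k`.
  have hrec : ∀ k, t (k + 2) = s * (Oᵀ * (W ^ (k + 1) * T)).trace
      - b * s * (Oᵀ * (W ^ k * O)).trace + b ^ 2 * t k := fun k => by
    have h1 : W ^ (k + 2) = s • (T * (Oᵀ * W ^ (k + 1))) - b • (R * W * W ^ k) := by
      rw [Matrix.mul_assoc R, ← pow_succ', ← Matrix.mul_assoc T, ← Matrix.smul_mul s,
        ← Matrix.smul_mul b, ← Matrix.sub_mul, ← hW, ← pow_succ']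
    simp only [ht]
    rw [h1, hRW, Matrix.trace_sub, Matrix.trace_smul, Matrix.trace_mul_comm T, Matrix.sub_mul,
      Matrix.smul_mul, Matrix.smul_mul, Matrix.one_mul, Matrix.mul_assoc O,
      Matrix.trace_smul, Matrix.trace_sub, Matrix.trace_smul, Matrix.trace_smul,
      Matrix.trace_mul_comm O, Matrix.mul_assoc, Matrix.mul_assoc]
    simp only [smul_eq_mul]
    ring
  have hT : ∀ k, (Oᵀ * (W ^ (k + 1) * T)).trace = y (k + 1) - b * d * x k := fun k => by
    rw [hpow, Matrix.mul_sub, Matrix.mul_smul, ← Matrix.mul_assoc, ← Matrix.mul_assoc, hOT, hOO,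
      Matrix.smul_mul, Matrix.one_mul, Matrix.trace_sub, Matrix.trace_smul, Matrix.trace_smul]
    simp only [smul_eq_mul, hx, hy]
    ring
  have hO : ∀ k, (Oᵀ * (W ^ (k + 1) * O)).trace = (s * d - b) * (Oᵀ * (W ^ k * T)).trace :=
    fun k => by
      rw [pow_succ, Matrix.mul_assoc, hWO, Matrix.mul_smul, Matrix.mul_smul, Matrix.trace_smul,
        smul_eq_mul]
  -- The reductions `hO` and `hT` need a positive power of `W`, so for `k = 0` and `k = 1` the trace
  -- containing `O` on both sides is computed by hand.
  have hd : ∀ k, t (k + 2) - D (k + 2) = b ^ 2 * (t k - D k) := fun k => by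
    match k with
    | 0 =>
      have h0 : (Oᵀ * (W ^ 0 * O)).trace = d * Fintype.card V := by
        simp [hOO, Matrix.trace_smul]
      have e1 := hrec 0
      have e2 := hT 0
      have e3 := hxy 0
      have e4 := hDx 0
      simp only [zero_add] at e1 e2 e3 e4 ⊢
      rw [e1, h0, e2, e4, hD0]
      rw [hx0] at *
      linear_combination e3 + 2 * Fintype.card V * hσ
    | 1 =>
      have h0 : (Oᵀ * (W ^ 1 * O)).trace = 0 := by
        rw [hO 0]; simp [hOT, hA]
      have e1 := hrec 1
      have e2 := hT 1
      have e3 := hxy 1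
      have e4 := hDx 1
      norm_num at e1 e2 e3 e4 ⊢
      rw [pow_one] at h0
      rw [e1, h0, e2, e4, hD1]
      rw [hx1] at *
      linear_combination e3
    | k + 2 =>
      rw [hrec, hO, hT, hT, hDx, hDx]
      linear_combination hxy (k + 2) + (-b * (s * d - b)) * hxy k +
        2 * x (k + 2) * hσ - (s * d * b) * x k * hσ
  suffices h : ∀ k, t k - D k =
      ((Fintype.card E : ℝ) / 2 - Fintype.card V) * (b ^ k + (-b) ^ k) by
    have := h k
    simp only [ht, hD] at this
    linarith
  intro k
  induction k using Nat.strong_induction_on with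
  | _ k ih =>
    match k with
    | 0 => rw [ht0, hD0]; ring
    | 1 => rw [ht1, hD1]; ring
    | k + 2 => rw [hd, ih k (by omega)]; ring

end TraceFormula

/-! ### Powers of a matrix as sums over cycles -/

theorem matrix_pow_succ_apply_eq_sum {ι R : Type*} [Fintype ι] [DecidableEq ι] [CommRing R]
    (M : Matrix ι ι R) (k : ℕ) (i j : ι) :
    (M ^ (k + 1)) i j = ∑ c : Fin (k + 1) → ι,
      if c 0 = i then (∏ l : Fin k, M (c l.castSucc) (c l.succ)) * M (c (Fin.last k)) j
      else 0 := by
  induction k generalizing i with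
  | zero =>
    rw [show (M ^ (0 + 1)) i j = M i j by rw [zero_add, pow_one],
      ← (Equiv.funUnique (Fin 1) ι).symm.sum_comp]
    simp [Fin.last_zero]
  | succ k ih =>
    rw [pow_succ', Matrix.mul_apply, ← (Fin.consEquiv fun _ => ι).sum_comp,
      Fintype.sum_prod_type]
    simp only [Fin.consEquiv_apply, Fin.cons_zero, ih, Finset.mul_sum]
    conv_rhs => rw [Finset.sum_eq_single i (fun l _ hl => by simp [hl]) (by simp)]
    rw [Finset.sum_comm]
    refine Finset.sum_congr rfl fun c _ => ?_
    rw [Finset.sum_eq_single (c 0) (fun l _ hl => by rw [if_neg hl.symm, mul_zero]) (by simp),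
      if_pos rfl, if_pos rfl, Fin.prod_univ_succ, ← Fin.succ_last, Fin.cons_succ]
    simp only [Fin.castSucc_zero, Fin.cons_zero, Fin.cons_succ, ← Fin.succ_castSucc]
    rw [mul_assoc]

/-- On the diagonal the closing factor is the one of index `Fin.last k`, because `Fin.last k + 1 =
0` in `Fin (k + 1)`. -/
theorem matrix_pow_succ_diag_eq_sum {ι R : Type*} [Fintype ι] [DecidableEq ι] [CommRing R]
    (M : Matrix ι ι R) (k : ℕ) (i : ι) :
    (M ^ (k + 1)) i i = ∑ c : Fin (k + 1) → ι,
      if c 0 = i then ∏ l, M (c l) (c (l + 1)) else 0 := by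
  rw [matrix_pow_succ_apply_eq_sum]
  refine Finset.sum_congr rfl fun c _ => ?_
  split_ifs with h
  · rw [Fin.prod_univ_castSucc]
    simp [Fin.coeSucc_eq_succ, h]
  · rfl

end GroverZeta

namespace GroverZeta

open Polynomial Matrix

set_option linter.unusedSectionVars false

/-! ### The arc matrix of a finite regular graph -/

section ArcMatrix

open Classical

variable {V : Type*} [Fintype V] (G : SimpleGraph V) [G.LocallyFinite]

/-- The matrix of the weights `w(f, e)`. -/
noncomputable def arcMatrix (a b : ℝ) : Matrix G.Dart G.Dart ℝ := Matrix.of (arcWeight G a b)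

/-- The incidence matrix of arcs and their origins. -/
noncomputable def originMatrix : Matrix G.Dart V ℝ :=
  Matrix.of fun e v => if e.fst = v then 1 else 0

/-- The incidence matrix of arcs and their termini. -/
noncomputable def terminusMatrix : Matrix G.Dart V ℝ :=
  Matrix.of fun e v => if e.snd = v then 1 else 0

/-- The permutation matrix of the reversal of arcs. -/
noncomputable def reversalMatrix : Matrix G.Dart G.Dart ℝ :=
  Matrix.of fun e f => if e.symm = f then 1 else 0

theorem reversalMatrix_mul_originMatrix :
    reversalMatrix G * originMatrix G = terminusMatrix G := by
  ext e v
  simp only [Matrix.mul_apply, reversalMatrix, originMatrix, terminusMatrix, of_apply, ite_mul,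
    one_mul, zero_mul, Finset.sum_ite_eq, Finset.mem_univ, if_true]
  rfl

theorem reversalMatrix_mul_self : reversalMatrix G * reversalMatrix G = 1 := by
  ext e f
  simp only [Matrix.mul_apply, reversalMatrix, of_apply, ite_mul, one_mul, zero_mul,
    Finset.sum_ite_eq, Finset.mem_univ, if_true, Matrix.one_apply, SimpleGraph.Dart.symm_symm]

theorem trace_reversalMatrix : (reversalMatrix G).trace = 0 := by
  simp [Matrix.trace, reversalMatrix, SimpleGraph.Dart.symm_ne]

/-- Counting lemmas for darts use a `Fintype` instance on neighbour sets other than the one from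
`LocallyFinite`; the degree does not depend on it. -/
theorem degree_eq_of_isRegularOfDegree {d : ℕ} (h : G.IsRegularOfDegree d) (v : V)
    (i : Fintype (G.neighborSet v)) : @SimpleGraph.degree V G v i = d := by
  rw [← h v]
  congr!

theorem originMatrix_transpose_mul_self {d : ℕ} (h : G.IsRegularOfDegree d) :
    (originMatrix G)ᵀ * originMatrix G = (d : ℝ) • (1 : Matrix V V ℝ) := by
  ext v w
  have h1 := (G.dart_fst_fiber_card_eq_degree v).trans (degree_eq_of_isRegularOfDegree G h v _)
  rcases eq_or_ne v w with rfl | hvw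
  · rw [← h1, Finset.card_filter]
    simp only [Matrix.mul_apply, originMatrix, transpose_apply, of_apply, Matrix.smul_apply,
      Matrix.one_apply_eq, smul_eq_mul, mul_one, Nat.cast_sum, Nat.cast_ite, Nat.cast_one,
      Nat.cast_zero]
    refine Finset.sum_congr rfl fun e _ => ?_
    split_ifs <;> simp
  · simp only [Matrix.mul_apply, originMatrix, transpose_apply, of_apply, Matrix.smul_apply,
      Matrix.one_apply_ne hvw, smul_zero]
    refine Finset.sum_eq_zero fun e _ => ?_
    by_cases he : e.fst = v
    · simp [he, hvw]
    · simp [he]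

theorem originMatrix_transpose_mul_terminusMatrix :
    (originMatrix G)ᵀ * terminusMatrix G = G.adjMatrix ℝ := by
  ext v w
  simp only [Matrix.mul_apply, originMatrix, terminusMatrix, transpose_apply, of_apply,
    SimpleGraph.adjMatrix_apply]
  split_ifs with hvw
  · rw [Finset.sum_eq_single ⟨(v, w), hvw⟩]
    · simp
    · rintro ⟨⟨v', w'⟩, h⟩ _ hne
      by_cases h1 : v' = v
      · subst h1
        have : w' ≠ w := by rintro rfl; exact hne rfl
        simp [this]
      · simp [h1]
    · simp
  · refine Finset.sum_eq_zero fun e _ => ?_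
    by_cases h1 : e.fst = v
    · have : e.snd ≠ w := by rintro rfl; exact hvw (h1 ▸ e.adj)
      simp [this]
    · simp [h1]

/-- The reversed arc also starts at the terminus of `f`, so all continuations get the common weight
`s` and backtracking is corrected by `-b`. -/
theorem arcMatrix_eq {d : ℕ} (h : G.IsRegularOfDegree d) (a b : ℝ) :
    arcMatrix G a b = ((2 / (d : ℝ) - 1) * a + b) • (terminusMatrix G * (originMatrix G)ᵀ)
      - b • reversalMatrix G := by
  ext f e
  have h1 : f = e.symm ↔ f.symm = e := by
    constructor <;> rintro rfl <;> simp
  simp only [arcMatrix, of_apply, arcWeight, h f.snd, Matrix.sub_apply, Matrix.smul_apply,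
    Matrix.mul_apply, terminusMatrix, originMatrix, reversalMatrix, transpose_apply, h1]
  by_cases h2 : f.symm = e
  · subst h2; simp
  · simp [h2, eq_comm]

theorem trace_arcMatrix_pow {d : ℕ} (h : G.IsRegularOfDegree d) (a b s : ℝ)
    (hs : s = (2 / (d : ℝ) - 1) * a + b) (k : ℕ) :
    (arcMatrix G a b ^ k).trace =
      (aeval (s • G.adjMatrix ℝ) (dickson 1 (b * (s * d - b)) k)).trace
        + Fintype.card V * (((d : ℝ) / 2 - 1) * (b ^ k + (-b) ^ k)) := by
  have hE : (Fintype.card G.Dart : ℝ) = Fintype.card V * d := by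
    have h1 := G.dart_card_eq_sum_degrees.trans
      (Finset.sum_const_nat fun v _ => degree_eq_of_isRegularOfDegree G h v _)
    exact_mod_cast h1
  rw [arcMatrix_eq G h, ← hs, trace_grover_pow (reversalMatrix_mul_originMatrix G)
    (reversalMatrix_mul_self G) (originMatrix_transpose_mul_self G h)
    (originMatrix_transpose_mul_terminusMatrix G) (SimpleGraph.trace_adjMatrix ℝ G)
    (trace_reversalMatrix G), hE]
  ring

/-- The weight vanishes on sequences that are not closed paths, so the sum may run over all
sequences of arcs whose first arc starts at `x`. -/
theorem cycleSum_eq_sum_arcMatrix_pow (a b : ℝ) (x : V) (k : ℕ) :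
    cycleSum G a b x (k + 1) =
      ∑ e : G.Dart, if e.fst = x then (arcMatrix G a b ^ (k + 1)) e e else 0 := by
  have h1 : cycleSum G a b x (k + 1) =
      ∑ c : Fin (k + 1) → G.Dart, if (c 0).fst = x then cycleWeight G a b c else 0 := by
    rw [cycleSum, finsum_mem_def, finsum_eq_sum_of_fintype]
    refine Finset.sum_congr rfl fun c _ => ?_
    by_cases hc : IsCycleAt G x c
    · rw [Set.indicator_of_mem (by exact hc), if_pos hc.1]
    · rw [Set.indicator_of_notMem (by exact hc)]
      split_ifs with h0
      · have : ∃ i, (c i).snd ≠ (c (i + 1)).fst := by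
          by_contra! h
          exact hc ⟨h0, h⟩
        obtain ⟨i, hi⟩ := this
        refine (Finset.prod_eq_zero (Finset.mem_univ i) ?_).symm
        have h2 : c i ≠ (c (i + 1)).symm := fun h => hi (by rw [h]; rfl)
        simp [arcWeight, h2, hi]
      · rfl
  rw [h1]
  simp only [matrix_pow_succ_diag_eq_sum]
  have h2 : ∀ e : G.Dart, (if e.fst = x then ∑ c : Fin (k + 1) → G.Dart,
      (if c 0 = e then ∏ l, arcMatrix G a b (c l) (c (l + 1)) else 0) else 0)
      = ∑ c : Fin (k + 1) → G.Dart, if c 0 = e then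
        (if (c 0).fst = x then cycleWeight G a b c else 0) else 0 := fun e => by
    split_ifs with h
    · refine Finset.sum_congr rfl fun c _ => ?_
      split_ifs with h3 h4
      · rfl
      · exact absurd (h3 ▸ h) h4
      · rfl
    · refine (Finset.sum_eq_zero fun c _ => ?_).symm
      split_ifs with h3 h4
      · exact absurd (h3 ▸ h4) h
      · rfl
      · rfl
  rw [Finset.sum_congr rfl fun e _ => h2 e, Finset.sum_comm]
  simp

/-- An automorphism permutes the arcs and fixes the weight matrix, hence its powers. Regularity
makes the degree in the weights a constant. -/
theorem cycleSum_iso {d : ℕ} (h : G.IsRegularOfDegree d) (a b : ℝ) (φ : G ≃g G) (x : V) (k : ℕ) :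
    cycleSum G a b (φ x) (k + 1) = cycleSum G a b x (k + 1) := by
  let ψ : G.Dart ≃ G.Dart :=
    { toFun := φ.toHom.mapDart
      invFun := φ.symm.toHom.mapDart
      left_inv := fun e => by ext <;> simp
      right_inv := fun e => by ext <;> simp }
  have hf : ∀ e, (ψ e).fst = φ e.fst := fun e => rfl
  have hs : ∀ e, (ψ e).snd = φ e.snd := fun e => rfl
  have hψ : ∀ e, (ψ e).symm = ψ e.symm := fun e => by ext <;> rfl
  have hW : (arcMatrix G a b).submatrix ψ ψ = arcMatrix G a b := by
    ext f e
    simp [arcMatrix, arcWeight, h _, hf, hs, hψ]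
  have hp : ∀ m : ℕ, (arcMatrix G a b ^ m).submatrix ψ ψ = arcMatrix G a b ^ m := fun m => by
    induction m with
    | zero => simp
    | succ m ih => rw [pow_succ, ← Matrix.submatrix_mul_equiv _ _ _ ψ, ih, hW]
  rw [cycleSum_eq_sum_arcMatrix_pow, cycleSum_eq_sum_arcMatrix_pow, ← ψ.sum_comp]
  refine Finset.sum_congr rfl fun e _ => ?_
  conv_rhs => rw [← hp]
  simp [hf]

theorem aeval_smul_adjMatrix_apply_iso (φ : G ≃g G) (s : ℝ) (p : ℝ[X]) (x : V) :
    (aeval (s • G.adjMatrix ℝ) p) (φ x) (φ x) = (aeval (s • G.adjMatrix ℝ) p) x x := by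
  have hA : (s • G.adjMatrix ℝ).submatrix φ φ = s • G.adjMatrix ℝ := by
    ext v w
    simp [SimpleGraph.adjMatrix_apply, φ.map_adj_iff]
  have hp : ∀ p : ℝ[X], (aeval (s • G.adjMatrix ℝ) p).submatrix φ φ
      = aeval (s • G.adjMatrix ℝ) p := fun p => by
    have := (Polynomial.aeval_algHom_apply (Matrix.reindexAlgEquiv ℝ ℝ φ.symm.toEquiv)
      (s • G.adjMatrix ℝ) p)
    have h2 : Matrix.reindexAlgEquiv ℝ ℝ φ.symm.toEquiv (s • G.adjMatrix ℝ)
      = s • G.adjMatrix ℝ := hA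
    rw [h2] at this
    exact this.symm
  conv_rhs => rw [← hp]
  rfl

/-- In the trace formula both traces are `|V|` times the contribution of a single vertex; divide by
`|V|`. -/
theorem cycleSum_eq {d : ℕ} (h : G.IsRegularOfDegree d) (hG : IsVertexTransitive G) (a b s : ℝ)
    (hs : s = (2 / (d : ℝ) - 1) * a + b) (x : V) (k : ℕ) :
    cycleSum G a b x (k + 1) =
      (aeval (s • G.adjMatrix ℝ) (dickson 1 (b * (s * d - b)) (k + 1))) x x
        + ((d : ℝ) / 2 - 1) * (b ^ (k + 1) + (-b) ^ (k + 1)) := by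
  have h1 := trace_arcMatrix_pow G h a b s hs (k + 1)
  set D := aeval (s • G.adjMatrix ℝ) (dickson 1 (b * (s * d - b)) (k + 1)) with hD
  have h2 : (arcMatrix G a b ^ (k + 1)).trace = Fintype.card V * cycleSum G a b x (k + 1) := by
    have : ∀ y, cycleSum G a b y (k + 1) = cycleSum G a b x (k + 1) := fun y => by
      obtain ⟨φ, rfl⟩ := hG x y
      exact cycleSum_iso G h a b φ x k
    calc (arcMatrix G a b ^ (k + 1)).trace = ∑ y, cycleSum G a b y (k + 1) := by
          simp only [cycleSum_eq_sum_arcMatrix_pow, Matrix.trace, Matrix.diag]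
          rw [Finset.sum_comm]
          simp
      _ = _ := by simp [this]
  have h3 : D.trace = Fintype.card V * D x x := by
    have : ∀ y, D y y = D x x := fun y => by
      obtain ⟨φ, rfl⟩ := hG x y
      exact aeval_smul_adjMatrix_apply_iso G φ s _ x
    simp [Matrix.trace, this]
  have hV : (Fintype.card V : ℝ) ≠ 0 := by
    have : Nonempty V := ⟨x⟩
    exact_mod_cast Fintype.card_ne_zero
  rw [h2, h3, ← mul_add] at h1
  exact mul_left_cancel₀ hV h1

end ArcMatrix

end GroverZeta

namespace GroverZeta

/-! ### Spectral measures of bounded self-adjoint operators -/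

section SpectralMeasure

open CompactlySupported Polynomial

variable {E : Type*} [NormedAddCommGroup E] [InnerProductSpace ℂ E] [CompleteSpace E]
  {T : E →L[ℂ] E} {M : ℝ}

theorem spectrum_subset_Icc_of_norm_le (hM : ‖T‖ ≤ M) : spectrum ℝ T ⊆ Set.Icc (-M) M := by
  intro t ht
  have h1 := spectrum.norm_le_norm_mul_of_mem ht
  -- Only an inequality, since `E` may be trivial.
  have h2 : ‖(1 : E →L[ℂ] E)‖ ≤ 1 := ContinuousLinearMap.norm_id_le
  rw [Real.norm_eq_abs] at h1
  exact abs_le.1 (h1.trans ((mul_le_of_le_one_right (norm_nonneg _) h2).trans hM))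

theorem integral_compactlySupported_spectralMeasure (T : E →L[ℂ] E) (x : E)
    (f : C_c(ℝ, ℝ)) :
    ∫ t, f t ∂(spectralMeasure T x) = (inner ℂ x (cfc (fun t : ℝ => f t) T x)).re :=
  RealRMK.integral_rieszMeasure _ f

/-- By regularity it suffices to treat compact subsets of the complement. A bump function equal to 1
on such a set and to 0 on the interval vanishes on the spectrum, so its functional calculus is 0. -/
theorem spectralMeasure_compl_Icc (hM : ‖T‖ ≤ M) (x : E) :
    spectralMeasure T x (Set.Icc (-M) M)ᶜ = 0 := by
  have hopen : IsOpen (Set.Icc (-M) M)ᶜ := isClosed_Icc.isOpen_compl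
  have hreg : (spectralMeasure T x).InnerRegularCompactLTTop := by
    unfold spectralMeasure; infer_instance
  have : (spectralMeasure T x).Regular := by
    unfold spectralMeasure RealRMK.rieszMeasure; infer_instance
  rw [hopen.measure_eq_iSup_isCompact]
  simp only [ENNReal.iSup_eq_zero]
  intro K hK hKc
  obtain ⟨f, hf1, hf0, hfc, hfI⟩ := exists_continuous_one_zero_of_isCompact hKc
    (isClosed_Icc (a := -M) (b := M)) (Set.disjoint_left.2 fun t ht => hK ht)
  have h1 := RealRMK.rieszMeasure_le_of_eq_one (spectralFunctional T x) (f := ⟨f, hfc⟩)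
    (fun t => (hfI t).1) hKc (fun t ht => hf1 ht)
  have h2 : spectralFunctional T x ⟨f, hfc⟩ = 0 := by
    change (inner ℂ x (cfc (fun t : ℝ => f t) T x)).re = 0
    have : cfc (fun t : ℝ => f t) T = 0 := by
      rw [cfc_congr (g := fun _ => 0) fun t ht => hf0 (spectrum_subset_Icc_of_norm_le hM ht)]
      exact cfc_const_zero ℝ T
    simp [this]
  rw [h2, ENNReal.ofReal_zero] at h1
  exact le_antisymm h1 zero_le

theorem ae_spectralMeasure_mem_Icc (hM : ‖T‖ ≤ M) (x : E) :
    ∀ᵐ t ∂(spectralMeasure T x), t ∈ Set.Icc (-M) M :=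
  spectralMeasure_compl_Icc hM x

/-- Multiplying by a cutoff equal to 1 on `[-‖T‖, ‖T‖]` changes neither side, so compact support can
be dropped. -/
theorem integral_spectralMeasure (T : E →L[ℂ] E) (x : E) {f : ℝ → ℝ} (hf : Continuous f) :
    ∫ t, f t ∂(spectralMeasure T x) = (inner ℂ x (cfc f T x)).re := by
  obtain ⟨χ, hχ1, -, hχc, -⟩ := exists_continuous_one_zero_of_isCompact
    (isCompact_Icc (a := -‖T‖) (b := ‖T‖)) isClosed_empty (Set.disjoint_empty _)
  let g : C_c(ℝ, ℝ) := ⟨⟨fun t => f t * χ t, by fun_prop⟩, hχc.mul_left⟩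
  have hg : ∀ t ∈ Set.Icc (-‖T‖) ‖T‖, g t = f t := fun t ht => by
    change f t * χ t = f t
    rw [hχ1 ht, Pi.one_apply, mul_one]
  have h1 := integral_compactlySupported_spectralMeasure T x g
  rw [cfc_congr (g := f) fun t ht => hg t (spectrum_subset_Icc_of_norm_le le_rfl ht)] at h1
  rw [← h1]
  refine integral_congr_ae ?_
  filter_upwards [ae_spectralMeasure_mem_Icc le_rfl x] with t ht using (hg t ht).symm

theorem integral_polynomial_spectralMeasure (hT : IsSelfAdjoint T) (x : E) (p : ℝ[X]) :
    ∫ t, p.eval t ∂(spectralMeasure T x) = (inner ℂ x (aeval T p x)).re := by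
  rw [integral_spectralMeasure T x p.continuous, cfc_polynomial p T]

theorem isProbabilityMeasure_spectralMeasure (hT : IsSelfAdjoint T) {x : E} (hx : ‖x‖ = 1) :
    IsProbabilityMeasure (spectralMeasure T x) := by
  have h1 := integral_polynomial_spectralMeasure hT x 1
  have h2 : (inner ℂ x x).re = 1 := by
    rw [inner_self_eq_norm_sq_to_K, hx]; simp
  simp only [eval_one, integral_const, smul_eq_mul, mul_one, map_one,
    one_apply_eq_self, h2] at h1
  refine ⟨?_⟩
  -- Infinite mass is excluded because its `toReal` would be 0.
  rw [Measure.real, ENNReal.toReal_eq_one_iff] at h1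
  exact h1

theorem integral_comp_spectralMeasure (hT : IsSelfAdjoint T) (x : E) {g f : ℝ → ℝ}
    (hg : Continuous g) (hf : Continuous f) :
    ∫ t, g t ∂(spectralMeasure (cfc f T) x) = ∫ t, g (f t) ∂(spectralMeasure T x) := by
  rw [integral_spectralMeasure _ x hg, integral_spectralMeasure T x (f := fun t => g (f t))
    (hg.comp hf), cfc_comp' g f T hg.continuousOn hf.continuousOn]

theorem smul_id_sub_smul_eq_cfc (hT : IsSelfAdjoint T) (c : ℝ) :
    (c : ℂ) • ContinuousLinearMap.id ℂ E - (c : ℂ) • T = cfc (fun t : ℝ => c * (1 - t)) T := by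
  rw [cfc_const_mul c _ T, cfc_sub (a := T) (fun _ => 1) (fun t => t), cfc_const_one ℝ T,
    cfc_id' ℝ T, smul_sub]
  rfl

end SpectralMeasure

/-! ### The operators of a regular graph -/

section Operators

open scoped Classical in
theorem delta_apply {V : Type*} (x v : V) : delta x v = if v = x then 1 else 0 := by
  simp [delta, Pi.single_apply]

variable {V : Type*} {G : SimpleGraph V} [G.LocallyFinite] {d : ℕ}

theorem inner_delta (x : V) (f : lp (fun _ : V => ℂ) 2) : inner ℂ (delta x) f = f x := by
  simp [delta, lp.inner_single_left]

theorem norm_delta (x : V) : ‖delta x‖ = 1 := by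
  simp [delta, lp.norm_single]

theorem adjOp_delta (h : G.IsRegularOfDegree d) (v : V) :
    adjOp h (delta v) = ∑ w ∈ G.neighborFinset v, delta w := by
  classical
  ext w
  rw [adjOp_apply, lp.coeFn_sum, Finset.sum_apply]
  simp only [delta_apply, Finset.sum_ite_eq, Finset.sum_ite_eq', SimpleGraph.mem_neighborFinset,
    G.adj_comm]

theorem isSelfAdjoint_adjOp (h : G.IsRegularOfDegree d) : IsSelfAdjoint (adjOp h) := by
  rw [ContinuousLinearMap.isSelfAdjoint_iff']
  ext f v
  rw [← inner_delta v, ContinuousLinearMap.adjoint_inner_right, adjOp_delta, sum_inner]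
  simp only [inner_delta]
  rfl

theorem norm_adjOp_le (h : G.IsRegularOfDegree d) : ‖adjOp h‖ ≤ d :=
  LinearMap.mkContinuous_norm_le _ (Nat.cast_nonneg d) _

theorem isSelfAdjoint_transitionOp (h : G.IsRegularOfDegree d) :
    IsSelfAdjoint (transitionOp h) := by
  refine IsSelfAdjoint.smul ?_ (isSelfAdjoint_adjOp h)
  simp [isSelfAdjoint_iff]

theorem norm_transitionOp_le (h : G.IsRegularOfDegree d) : ‖transitionOp h‖ ≤ 1 := by
  rw [transitionOp, norm_smul, norm_inv, Complex.norm_natCast]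
  rcases Nat.eq_zero_or_pos d with rfl | hd
  · simp
  · rw [inv_mul_le_one₀ (by exact_mod_cast hd)]
    exact norm_adjOp_le h

theorem laplacianOp_eq (h : G.IsRegularOfDegree d) (hd : d ≠ 0) :
    laplacianOp h
      = ((d : ℝ) : ℂ) • ContinuousLinearMap.id ℂ _ - ((d : ℝ) : ℂ) • transitionOp h := by
  have hd' : (d : ℂ) ≠ 0 := by exact_mod_cast hd
  rw [laplacianOp, transitionOp, Complex.ofReal_natCast, smul_smul, mul_inv_cancel₀ hd', one_smul]

theorem isProbabilityMeasure_transitionMeasure (h : G.IsRegularOfDegree d) (x : V) :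
    IsProbabilityMeasure (transitionMeasure h x) :=
  isProbabilityMeasure_spectralMeasure (isSelfAdjoint_transitionOp h) (norm_delta x)

theorem ae_transitionMeasure_mem_Icc (h : G.IsRegularOfDegree d) (x : V) :
    ∀ᵐ t ∂(transitionMeasure h x), t ∈ Set.Icc (-1 : ℝ) 1 :=
  ae_spectralMeasure_mem_Icc (norm_transitionOp_le h) _

theorem isProbabilityMeasure_laplacianMeasure (h : G.IsRegularOfDegree d) (hd : d ≠ 0) (x : V) :
    IsProbabilityMeasure (laplacianMeasure h x) := by
  refine isProbabilityMeasure_spectralMeasure ?_ (norm_delta x)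
  rw [laplacianOp_eq h hd, smul_id_sub_smul_eq_cfc (isSelfAdjoint_transitionOp h)]
  exact cfc_predicate _ _

theorem integral_laplacianMeasure (h : G.IsRegularOfDegree d) (hd : d ≠ 0) (x : V)
    {f : ℝ → ℝ} (hf : Continuous f) :
    ∫ t, f t ∂(laplacianMeasure h x) = ∫ t, f (d * (1 - t)) ∂(transitionMeasure h x) := by
  rw [laplacianMeasure, laplacianOp_eq h hd,
    smul_id_sub_smul_eq_cfc (isSelfAdjoint_transitionOp h),
    integral_comp_spectralMeasure (isSelfAdjoint_transitionOp h) _ hf (by fun_prop)]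
  rfl

open Polynomial in
theorem integral_polynomial_transitionMeasure (h : G.IsRegularOfDegree d) (x : V) (p : ℝ[X]) :
    ∫ t, p.eval t ∂(transitionMeasure h x) = (aeval (transitionOp h) p (delta x) x).re := by
  rw [transitionMeasure, integral_polynomial_spectralMeasure (isSelfAdjoint_transitionOp h),
    inner_delta]
  rfl

open Polynomial in
open scoped Classical in
theorem aeval_adjOp_delta_apply [Fintype V] (h : G.IsRegularOfDegree d) (p : ℝ[X]) (x v : V) :
    aeval (adjOp h) p (delta x) v = (((aeval (G.adjMatrix ℝ) p) v x : ℝ) : ℂ) := by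
  have hpow : ∀ (k : ℕ) (v : V), (adjOp h ^ k) (delta x) v = ((G.adjMatrix ℝ ^ k) v x : ℝ) := by
    intro k
    induction k with
    | zero => intro v; simp [delta_apply, Matrix.one_apply, apply_ite]
    | succ k ih =>
      intro v
      rw [pow_succ', mul_apply_eq_comp, adjOp_apply, pow_succ',
        SimpleGraph.adjMatrix_mul_apply]
      simp only [ih, Complex.ofReal_sum]
      congr!
  induction p using Polynomial.induction_on' with
  | add p q hp hq => simp [hp, hq]
  | monomial k a =>
    rw [aeval_monomial, aeval_monomial, Algebra.algebraMap_eq_smul_one,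
      Algebra.algebraMap_eq_smul_one, smul_mul_assoc, smul_mul_assoc, one_mul, one_mul,
      smul_apply, Matrix.smul_apply, smul_eq_mul, Complex.ofReal_mul, ← hpow]
    rfl

open Polynomial in
open scoped Classical in
-- Bridge from the operator on `ℓ²` to the matrix in the trace formula.
theorem integral_polynomial_transitionMeasure_eq_adjMatrix [Fintype V]
    (h : G.IsRegularOfDegree d) (x : V) (p : ℝ[X]) :
    ∫ t, p.eval t ∂(transitionMeasure h x) = (aeval ((d : ℝ)⁻¹ • G.adjMatrix ℝ) p) x x := by
  have h1 : transitionOp h = aeval (adjOp h) (C (d : ℝ)⁻¹ * X) := by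
    ext f v
    simp [transitionOp, Algebra.algebraMap_eq_smul_one]
  have h2 : (d : ℝ)⁻¹ • G.adjMatrix ℝ = aeval (G.adjMatrix ℝ) (C (d : ℝ)⁻¹ * X) := by
    simp [Algebra.algebraMap_eq_smul_one]
  rw [integral_polynomial_transitionMeasure, h1, h2, ← aeval_comp, ← aeval_comp,
    aeval_adjOp_delta_apply, Complex.ofReal_re]

end Operators

end GroverZeta

namespace GroverZeta

/-! ### Logarithmic series of a quadratic polynomial -/

section LogSeries

open Polynomial

/-- A nonreal root comes with its conjugate, so `‖z‖ ^ 2 = b c`. For a real root larger than both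
`|b|` and `|c|`, the products `(‖z‖ ∓ b) (‖z‖ ∓ c)` are positive, so `|b + c| ‖z‖ < z ^ 2 + b c = (b
+ c) l z`, impossible for `|l| ≤ 1`. -/
theorem norm_le_of_quadratic_root {b c l : ℝ} (hl : |l| ≤ 1) {z : ℂ}
    (hz : z ^ 2 - (b + c) * l * z + b * c = 0) : ‖z‖ ≤ max |b| |c| := by
  have hre := congrArg Complex.re hz
  have him := congrArg Complex.im hz
  simp only [pow_two, Complex.add_re, Complex.sub_re, Complex.mul_re, Complex.mul_im,
    Complex.add_im, Complex.sub_im, Complex.ofReal_re, Complex.ofReal_im, Complex.zero_re,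
    Complex.zero_im] at hre him
  have hn : ‖z‖ ^ 2 = z.re ^ 2 + z.im ^ 2 := by
    rw [← Complex.normSq_eq_norm_sq, Complex.normSq_apply]; ring
  have hb := le_max_left |b| |c|
  have hc := le_max_right |b| |c|
  have hb0 := abs_nonneg b
  by_contra! h
  have hb1 : |b| < ‖z‖ := hb.trans_lt h
  have hc1 : |c| < ‖z‖ := hc.trans_lt h
  by_cases hy : z.im = 0
  · rw [hy] at hre hn
    have h1 := abs_lt.1 hb1
    have h2 := abs_lt.1 hc1
    have e1 : 0 < (‖z‖ - b) * (‖z‖ - c) := mul_pos (by linarith) (by linarith)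
    have e2 : 0 < (‖z‖ + b) * (‖z‖ + c) := mul_pos (by linarith) (by linarith)
    have e3 : |(b + c) * ‖z‖| < ‖z‖ ^ 2 + b * c := abs_lt.2 ⟨by nlinarith, by nlinarith⟩
    have e4 : (b + c) * l * z.re = ‖z‖ ^ 2 + b * c := by rw [hn]; linarith
    have e5 : |z.re| ≤ ‖z‖ := Complex.abs_re_le_norm z
    have e6 : |(b + c) * l * z.re| ≤ |(b + c) * ‖z‖| := by
      rw [mul_assoc, abs_mul, abs_mul, abs_mul, abs_norm]
      gcongr
      calc |l| * |z.re| ≤ 1 * ‖z‖ := by gcongr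
        _ = ‖z‖ := one_mul _
    have e7 := le_abs_self ((b + c) * l * z.re)
    linarith
  · have e1 : 2 * z.re = (b + c) * l := by
      have : z.im * (2 * z.re - (b + c) * l) = 0 := by linarith
      rcases mul_eq_zero.1 this with h0 | h0
      · exact absurd h0 hy
      · linarith
    have e2 : ‖z‖ ^ 2 = b * c := by rw [hn]; simp only [← e1] at hre; nlinarith
    have e3 : b * c ≤ |b| * |c| := by rw [← abs_mul]; exact le_abs_self _
    nlinarith [mul_lt_mul'' hb1 hc1 hb0 (abs_nonneg c)]

theorem exists_quadratic_roots {b c l : ℝ} (hl : |l| ≤ 1) :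
    ∃ z w : ℂ, z + w = (b + c) * l ∧ z * w = b * c ∧
      ‖z‖ ≤ max |b| |c| ∧ ‖w‖ ≤ max |b| |c| := by
  obtain ⟨r, hr⟩ := IsAlgClosed.exists_pow_nat_eq (((b + c) * l : ℂ) ^ 2 - 4 * (b * c))
    (n := 2) (by norm_num)
  refine ⟨((b + c) * l + r) / 2, ((b + c) * l - r) / 2, by ring, ?_,
    norm_le_of_quadratic_root hl ?_, norm_le_of_quadratic_root hl ?_⟩
  · linear_combination (-1 / 4 : ℂ) * hr
  · linear_combination (1 / 4 : ℂ) * hr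
  · linear_combination (1 / 4 : ℂ) * hr

/-- Both factors lie in the right half-plane, so their arguments add up to something strictly
between `-π` and `π`. -/
theorem one_sub_mul_one_sub_mem_slitPlane {x y : ℂ} (hx : ‖x‖ < 1) (hy : ‖y‖ < 1) :
    (1 - x) * (1 - y) ∈ Complex.slitPlane ∧
      Complex.log ((1 - x) * (1 - y)) = Complex.log (1 - x) + Complex.log (1 - y) := by
  have hre : ∀ z : ℂ, ‖z‖ < 1 → 0 < (1 - z).re := fun z hz => by
    have := (abs_lt.1 ((Complex.abs_re_le_norm z).trans_lt hz)).2
    simp only [Complex.sub_re, Complex.one_re]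
    linarith
  have hx0 : 1 - x ≠ 0 := fun h => by simpa [h] using hre x hx
  have hy0 : 1 - y ≠ 0 := fun h => by simpa [h] using hre y hy
  have hx1 := abs_lt.1 (Complex.abs_arg_lt_pi_div_two_iff.2 (Or.inl (hre x hx)))
  have hy1 := abs_lt.1 (Complex.abs_arg_lt_pi_div_two_iff.2 (Or.inl (hre y hy)))
  have hmem : (1 - x).arg + (1 - y).arg ∈ Set.Ioc (-Real.pi) Real.pi :=
    ⟨by linarith, by linarith⟩
  refine ⟨Complex.mem_slitPlane_iff_arg.2 ⟨?_, mul_ne_zero hx0 hy0⟩,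
    Complex.log_mul hx0 hy0 hmem⟩
  rw [Complex.arg_mul hx0 hy0 hmem]
  linarith

theorem hasSum_pow_add_pow {z w u : ℂ} (hz : ‖z * u‖ < 1) (hw : ‖w * u‖ < 1) :
    HasSum (fun k : ℕ => (z ^ (k + 1) + w ^ (k + 1)) / ((k + 1 : ℕ) : ℂ) * u ^ (k + 1))
      (-Complex.log (1 - (z + w) * u + z * w * u ^ 2)) := by
  have h1 := (Complex.hasSum_taylorSeries_neg_log' hz).add
    (Complex.hasSum_taylorSeries_neg_log' hw)
  have h2 : 1 - (z + w) * u + z * w * u ^ 2 = (1 - z * u) * (1 - w * u) := by ring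
  rw [h2, (one_sub_mul_one_sub_mem_slitPlane hz hw).2, neg_add]
  refine h1.congr_fun ?_
  intro k
  push_cast
  ring

variable {b c l : ℝ}

theorem norm_mul_lt_one_of_norm_le_max {z u : ℂ} (hb : ‖u‖ * |b| < 1) (hc : ‖u‖ * |c| < 1)
    (hz : ‖z‖ ≤ max |b| |c|) : ‖z * u‖ < 1 := by
  rw [norm_mul, mul_comm]
  refine (mul_le_mul_of_nonneg_left hz (norm_nonneg u)).trans_lt ?_
  rcases max_choice |b| |c| with h | h <;> rw [h] <;> assumption

theorem quadratic_mem_slitPlane {u : ℂ} (hb : ‖u‖ * |b| < 1) (hc : ‖u‖ * |c| < 1)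
    (hl : |l| ≤ 1) : 1 + b * c * u ^ 2 - (b + c) * u * l ∈ Complex.slitPlane := by
  obtain ⟨z, w, h1, h2, hz, hw⟩ := exists_quadratic_roots (b := b) (c := c) hl
  have h := (one_sub_mul_one_sub_mem_slitPlane (norm_mul_lt_one_of_norm_le_max hb hc hz)
    (norm_mul_lt_one_of_norm_le_max hb hc hw)).1
  convert h using 1
  linear_combination u * h1 - u ^ 2 * h2

theorem ofReal_dickson_one_eval {z w : ℂ} (h1 : z + w = (b + c) * l) (h2 : z * w = b * c)
    (k : ℕ) : (((dickson 1 (b * c) k).eval ((b + c) * l) : ℝ) : ℂ) = z ^ k + w ^ k := by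
  rw [← dickson_one_eval_add, h1, h2]
  have := map_dickson (k := 1) (a := b * c) Complex.ofRealHom k
  rw [← Complex.ofRealHom_eq_coe, ← Polynomial.eval₂_at_apply, ← Polynomial.eval_map, this]
  simp

theorem abs_dickson_one_eval_le (hl : |l| ≤ 1) (k : ℕ) :
    |(dickson 1 (b * c) k).eval ((b + c) * l)| ≤ 2 * max |b| |c| ^ k := by
  obtain ⟨z, w, h1, h2, hz, hw⟩ := exists_quadratic_roots (b := b) (c := c) hl
  rw [← Real.norm_eq_abs, ← Complex.norm_real, ofReal_dickson_one_eval h1 h2, two_mul]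
  refine (norm_add_le _ _).trans ?_
  rw [norm_pow, norm_pow]
  gcongr

theorem hasSum_dickson_one_eval {u : ℂ} (hb : ‖u‖ * |b| < 1) (hc : ‖u‖ * |c| < 1)
    (hl : |l| ≤ 1) :
    HasSum (fun k : ℕ => (((dickson 1 (b * c) (k + 1)).eval ((b + c) * l) : ℝ) : ℂ)
        / ((k + 1 : ℕ) : ℂ) * u ^ (k + 1))
      (-Complex.log (1 + b * c * u ^ 2 - (b + c) * u * l)) := by
  obtain ⟨z, w, h1, h2, hz, hw⟩ := exists_quadratic_roots (b := b) (c := c) hl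
  have h := hasSum_pow_add_pow (norm_mul_lt_one_of_norm_le_max hb hc hz)
    (norm_mul_lt_one_of_norm_le_max hb hc hw)
  simp only [ofReal_dickson_one_eval h1 h2]
  rw [show 1 + b * c * u ^ 2 - (b + c) * u * l = 1 - (z + w) * u + z * w * u ^ 2 by
    rw [h1, h2]; ring]
  exact h

theorem hasSum_integral_dickson_one_eval {u : ℂ} (hb : ‖u‖ * |b| < 1) (hc : ‖u‖ * |c| < 1)
    {μ : Measure ℝ} [IsProbabilityMeasure μ] (hμ : ∀ᵐ t ∂μ, t ∈ Set.Icc (-1 : ℝ) 1) :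
    HasSum (fun k : ℕ => ((∫ t, (dickson 1 (b * c) (k + 1)).eval ((b + c) * t) ∂μ : ℝ) : ℂ)
        / ((k + 1 : ℕ) : ℂ) * u ^ (k + 1))
      (-∫ t : ℝ, Complex.log (1 + b * c * u ^ 2 - (b + c) * u * t) ∂μ) := by
  set ρ := ‖u‖ * max |b| |c| with hρ
  have hρ0 : 0 ≤ ρ := by positivity
  have hρ1 : ρ < 1 := by
    rcases max_choice |b| |c| with h | h <;> rw [hρ, h] <;> assumption
  have h := hasSum_integral_of_dominated_convergence (μ := μ)
    (F := fun (k : ℕ) (t : ℝ) =>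
      (((dickson 1 (b * c) (k + 1)).eval ((b + c) * t) : ℝ) : ℂ)
        / ((k + 1 : ℕ) : ℂ) * u ^ (k + 1))
    (f := fun t : ℝ => -Complex.log (1 + b * c * u ^ 2 - (b + c) * u * t))
    -- The Dickson bound `2 * max |b| |c| ^ (k + 1)` times `‖u‖ ^ (k + 1)`; the factor `1 / (k + 1)`
    -- is discarded.
    (fun k _ => 2 * ρ ^ (k + 1)) ?_ ?_ ?_ ?_ ?_
  · rw [integral_neg] at h
    refine h.congr_fun fun k => ?_
    rw [integral_mul_const, integral_div, integral_complex_ofReal]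
  · intro k
    refine Continuous.aestronglyMeasurable ?_
    have := (dickson 1 (b * c) (k + 1)).continuous
    fun_prop
  · intro k
    filter_upwards [hμ] with t ht
    rw [norm_mul, norm_div, Complex.norm_real, norm_pow, Complex.norm_natCast, Real.norm_eq_abs]
    have h1 := abs_dickson_one_eval_le (b := b) (c := c) (abs_le.2 ht) (k + 1)
    have h2 : |(dickson 1 (b * c) (k + 1)).eval ((b + c) * t)| / ((k + 1 : ℕ) : ℝ)
        ≤ |(dickson 1 (b * c) (k + 1)).eval ((b + c) * t)| :=
      div_le_self (abs_nonneg _) (by push_cast; linarith [(Nat.cast_nonneg k : (0 : ℝ) ≤ k)])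
    calc _ ≤ (2 * max |b| |c| ^ (k + 1)) * ‖u‖ ^ (k + 1) := by gcongr; exact h2.trans h1
      _ = _ := by rw [hρ, mul_pow]; ring
  · filter_upwards with t
    exact ((summable_nat_add_iff 1).2 (summable_geometric_of_lt_one hρ0 hρ1)).mul_left 2
  · exact integrable_const _
  · filter_upwards [hμ] with t ht
    exact hasSum_dickson_one_eval hb hc (abs_le.2 ht)

end LogSeries

/-! ### Weak limits of measures supported in an interval -/

section WeakConvergence

theorem ae_mem_Icc_of_weaklyConverges {μs : ℕ → Measure ℝ} {μ : Measure ℝ} [IsFiniteMeasure μ]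
    (h : WeaklyConverges μs μ) {r s : ℝ}
    (hs : ∀ n, ∀ᵐ t ∂(μs n), t ∈ Set.Icc r s) : ∀ᵐ t ∂μ, t ∈ Set.Icc r s := by
  -- The distance to `[r, s]`, truncated at 1: it vanishes exactly on the interval, and its zero
  -- integrals pass to the limit.
  let f : BoundedContinuousFunction ℝ ℝ := BoundedContinuousFunction.ofNormedAddCommGroup
    (fun t => min 1 (max 0 (max (r - t) (t - s)))) (by fun_prop) 1 (fun t => by
      rw [Real.norm_eq_abs, abs_le]
      exact ⟨by linarith [le_min zero_le_one (le_max_left (0 : ℝ) (max (r - t) (t - s)))],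
        min_le_left _ _⟩)
  have hf : ∀ t, f t = min 1 (max 0 (max (r - t) (t - s))) := fun t => rfl
  have h0 : ∀ t, 0 ≤ f t := fun t => le_min zero_le_one (le_max_left _ _)
  have h1 : ∀ n, ∫ t, f t ∂(μs n) = 0 := fun n => by
    refine integral_eq_zero_of_ae ?_
    filter_upwards [hs n] with t ht
    rw [hf, max_eq_left (max_le (by linarith [ht.1]) (by linarith [ht.2]))]
    simp
  have h2 : ∫ t, f t ∂μ = 0 := tendsto_nhds_unique (h f) (by simp [h1])
  rw [integral_eq_zero_iff_of_nonneg h0 (f.integrable μ)] at h2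
  filter_upwards [h2] with t ht
  rw [hf, Pi.zero_apply] at ht
  by_contra hcon
  have : 0 < max (r - t) (t - s) := by
    rw [lt_max_iff]
    by_contra! hh
    exact hcon ⟨by linarith, by linarith⟩
  have : 0 < min (1 : ℝ) (max 0 (max (r - t) (t - s))) :=
    lt_min one_pos (lt_max_of_lt_right this)
  linarith

theorem tendsto_integral_of_weaklyConverges {μs : ℕ → Measure ℝ} {μ : Measure ℝ}
    [∀ n, IsFiniteMeasure (μs n)] [IsFiniteMeasure μ] (h : WeaklyConverges μs μ) {r s : ℝ}
    (hrs : r ≤ s) (hs : ∀ n, ∀ᵐ t ∂(μs n), t ∈ Set.Icc r s) {f : ℝ → ℂ}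
    (hf : ContinuousOn f (Set.Icc r s)) :
    Integrable f μ ∧ Tendsto (fun n => ∫ t, f t ∂(μs n)) atTop (𝓝 (∫ t, f t ∂μ)) := by
  have hμ := ae_mem_Icc_of_weaklyConverges h hs
  set g : ℝ → ℂ := Set.IccExtend hrs (Set.domRestrict _ f) with hg
  have hgc : Continuous g := (continuousOn_iff_continuous_domRestrict.1 hf).Icc_extend'
  -- `g` extends `f` by its endpoint values, so it is globally continuous and bounded; its real and
  -- imaginary parts then serve as test functions.
  obtain ⟨C, hC⟩ : ∃ C, ∀ t, ‖g t‖ ≤ C := by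
    obtain ⟨C, hC⟩ := isCompact_Icc.exists_bound_of_continuousOn hf
    exact ⟨C, fun t => hC _ (Set.projIcc r s hrs t).2⟩
  have hfg : ∀ t ∈ Set.Icc r s, g t = f t := fun t ht => Set.IccExtend_of_mem hrs _ ht
  let gre : BoundedContinuousFunction ℝ ℝ := BoundedContinuousFunction.ofNormedAddCommGroup
    (fun t => (g t).re) (by fun_prop) C (fun t => (Complex.abs_re_le_norm _).trans (hC t))
  let gim : BoundedContinuousFunction ℝ ℝ := BoundedContinuousFunction.ofNormedAddCommGroup
    (fun t => (g t).im) (by fun_prop) C (fun t => (Complex.abs_im_le_norm _).trans (hC t))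
  have hint : ∀ ν : Measure ℝ, IsFiniteMeasure ν → Integrable g ν := fun ν _ =>
    Integrable.of_bound hgc.aestronglyMeasurable C (Eventually.of_forall hC)
  have hdec : ∀ ν : Measure ℝ, IsFiniteMeasure ν → (∀ᵐ t ∂ν, t ∈ Set.Icc r s) →
      ∫ t, f t ∂ν = ((∫ t, gre t ∂ν : ℝ) : ℂ) + ((∫ t, gim t ∂ν : ℝ) : ℂ) * Complex.I :=
    fun ν _ hν => by
      have h1 : ∫ t, f t ∂ν = ∫ t, g t ∂ν := integral_congr_ae (by
        filter_upwards [hν] with t ht using (hfg t ht).symm)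
      rw [h1]
      exact (integral_re_add_im (hint ν inferInstance)).symm
  refine ⟨(hint μ inferInstance).congr (by filter_upwards [hμ] with t ht using hfg t ht), ?_⟩
  rw [hdec μ inferInstance hμ]
  simp only [fun n => hdec (μs n) inferInstance (hs n)]
  exact ((Complex.continuous_ofReal.tendsto _).comp (h gre)).add
    (((Complex.continuous_ofReal.tendsto _).comp (h gim)).mul_const _)

open Polynomial in
theorem weaklyConverges_of_polynomial {μs : ℕ → Measure ℝ} {μ : Measure ℝ}
    [∀ n, IsProbabilityMeasure (μs n)] [IsProbabilityMeasure μ] {r s : ℝ}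
    (hs : ∀ n, ∀ᵐ t ∂(μs n), t ∈ Set.Icc r s) (hμ : ∀ᵐ t ∂μ, t ∈ Set.Icc r s)
    (h : ∀ p : ℝ[X], Tendsto (fun n => ∫ t, p.eval t ∂(μs n)) atTop (𝓝 (∫ t, p.eval t ∂μ))) :
    WeaklyConverges μs μ := by
  intro f
  rw [Metric.tendsto_atTop]
  intro ε hε
  obtain ⟨p, hp⟩ := exists_polynomial_near_of_continuousOn r s f f.continuous.continuousOn
    (ε / 4) (by positivity)
  have key : ∀ ν : Measure ℝ, IsProbabilityMeasure ν → (∀ᵐ t ∂ν, t ∈ Set.Icc r s) →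
      |∫ t, f t ∂ν - ∫ t, p.eval t ∂ν| ≤ ε / 4 := fun ν _ hν => by
    have hpi : Integrable (fun t => p.eval t) ν := by
      obtain ⟨C, hC⟩ := isCompact_Icc.exists_bound_of_continuousOn
        (p.continuous.continuousOn (s := Set.Icc r s))
      exact Integrable.of_bound p.continuous.aestronglyMeasurable C
        (by filter_upwards [hν] with t ht using hC t ht)
    rw [← integral_sub (f.integrable ν) hpi, ← Real.norm_eq_abs]
    refine (norm_integral_le_of_norm_le_const (C := ε / 4) ?_).trans (by simp)
    filter_upwards [hν] with t ht
    rw [← norm_neg, neg_sub, Real.norm_eq_abs]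
    exact (hp t ht).le
  obtain ⟨N, hN⟩ := Metric.tendsto_atTop.1 (h p) (ε / 4) (by positivity)
  refine ⟨N, fun n hn => ?_⟩
  have h1 := abs_le.1 (key (μs n) inferInstance (hs n))
  have h2 := abs_le.1 (key μ inferInstance hμ)
  have h3 := abs_lt.1 (Real.dist_eq _ _ ▸ hN n hn)
  rw [Real.dist_eq, abs_lt]
  constructor <;> linarith [h1.1, h1.2, h2.1, h2.2, h3.1, h3.2]

end WeakConvergence

end GroverZeta

namespace GroverZeta

open Polynomial

/-! ### Moments and local convergence -/

section LocalConvergence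

variable {V W : Type*} {G : SimpleGraph V} {H : SimpleGraph W} [G.LocallyFinite] [H.LocallyFinite]
  {d : ℕ}

theorem edist_le_of_adjOp_pow_delta_ne_zero (h : G.IsRegularOfDegree d) {x v : V} {k : ℕ}
    (hv : (adjOp h ^ k) (delta x) v ≠ 0) : G.edist v x ≤ k := by
  induction k generalizing v with
  | zero =>
    have : v = x := by
      by_contra hne
      simp [delta_apply, hne] at hv
    simp [this]
  | succ k ih =>
    rw [pow_succ', mul_apply_eq_comp, adjOp_apply] at hv
    obtain ⟨w, hw, hw0⟩ := Finset.exists_ne_zero_of_sum_ne_zero hv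
    rw [SimpleGraph.mem_neighborFinset] at hw
    calc G.edist v x ≤ G.edist v w + G.edist w x := G.edist_triangle
      _ ≤ 1 + k := add_le_add (SimpleGraph.edist_eq_one_iff_adj.2 hw).le (ih hw0)
      _ = ((k + 1 : ℕ) : ℕ∞) := by rw [add_comm]; rfl

theorem mem_ball_of_adjOp_pow_delta_ne_zero (h : G.IsRegularOfDegree d) {x v : V} {k r : ℕ}
    (hk : k < r) (hv : (adjOp h ^ k) (delta x) v ≠ 0) : v ∈ G.ball x r :=
  (edist_le_of_adjOp_pow_delta_ne_zero h hv).trans_lt (by exact_mod_cast hk)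

/-- A neighbour of `v` may lie outside the ball, but then the previous power vanishes there. So only
the nonzero terms of the neighbour sums are matched. -/
theorem adjOp_pow_delta_eq_of_ball_iso (hG : G.IsRegularOfDegree d) (hH : H.IsRegularOfDegree d)
    {x : V} {o : W} {r : ℕ} (e : G.induce (G.ball x r) ≃g H.induce (H.ball o r))
    (he : ∀ v, v.1 = x → (e v).1 = o) {k : ℕ} (hk : k < r) (v : G.ball x r) :
    (adjOp hG ^ k) (delta x) v.1 = (adjOp hH ^ k) (delta o) (e v).1 := by
  have hx : x ∈ G.ball x r := by
    rw [SimpleGraph.mem_ball, SimpleGraph.edist_self]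
    exact_mod_cast (Nat.zero_le k).trans_lt hk
  -- The hypothesis sends root to root; injectivity gives the converse.
  have he' : ∀ v, (e v).1 = o ↔ v.1 = x := fun v => by
    refine ⟨fun hv => ?_, he v⟩
    have : e v = e ⟨x, hx⟩ := Subtype.ext (hv.trans (he ⟨x, hx⟩ rfl).symm)
    rw [e.injective this]
  induction k generalizing v with
  | zero =>
    simp only [pow_zero, one_apply_eq_self, delta_apply]
    by_cases hv : v.1 = x
    · rw [if_pos hv, if_pos ((he' v).2 hv)]
    · rw [if_neg hv, if_neg (mt (he' v).1 hv)]
  | succ k ih =>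
    have ih := ih (by omega)
    simp only [pow_succ', mul_apply_eq_comp, adjOp_apply]
    refine Finset.sum_bij_ne_zero
      (fun w _ hw => (e ⟨w, mem_ball_of_adjOp_pow_delta_ne_zero hG (by omega) hw⟩).1) ?_ ?_ ?_ ?_
    · intro w hw hw0
      rw [SimpleGraph.mem_neighborFinset] at hw ⊢
      exact (e.map_adj_iff (v := v)
        (w := ⟨w, mem_ball_of_adjOp_pow_delta_ne_zero hG (by omega) hw0⟩)).2 hw
    · intro w _ _ w' _ _ hww
      exact congrArg Subtype.val (e.injective (Subtype.ext hww))
    · intro w hw hw0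
      have hwb := mem_ball_of_adjOp_pow_delta_ne_zero hH (r := r) (by omega) hw0
      have hes : e (e.symm ⟨w, hwb⟩) = ⟨w, hwb⟩ := e.apply_symm_apply _
      refine ⟨(e.symm ⟨w, hwb⟩).1, ?_, ?_, ?_⟩
      · rw [SimpleGraph.mem_neighborFinset] at hw ⊢
        refine (e.map_adj_iff (v := v) (w := e.symm ⟨w, hwb⟩)).1 ?_
        rw [hes]
        exact hw
      · rw [ih, hes]
        exact hw0
      · exact congrArg Subtype.val hes
    · intro w _ hw0
      exact ih ⟨w, _⟩

theorem integral_polynomial_transitionMeasure_eq_sum (h : G.IsRegularOfDegree d) (x : V)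
    (p : ℝ[X]) :
    ∫ t, p.eval t ∂(transitionMeasure h x) = ∑ k ∈ Finset.range (p.natDegree + 1),
      p.coeff k * ((d : ℂ)⁻¹ ^ k * (adjOp h ^ k) (delta x) x).re := by
  rw [integral_polynomial_transitionMeasure, aeval_eq_sum_range, transitionOp]
  simp only [_root_.smul_pow, sum_apply, smul_apply, lp.coeFn_sum, Finset.sum_apply, Complex.re_sum]
  refine Finset.sum_congr rfl fun k _ => ?_
  exact Complex.re_ofReal_mul _ _

/-- Balls are defined by a strict inequality, hence radius `natDegree + 1`. -/
theorem integral_polynomial_transitionMeasure_eq_of_ball_iso (hG : G.IsRegularOfDegree d)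
    (hH : H.IsRegularOfDegree d) {x : V} {o : W} (p : ℝ[X])
    (e : G.induce (G.ball x (p.natDegree + 1 : ℕ)) ≃g H.induce (H.ball o (p.natDegree + 1 : ℕ)))
    (he : ∀ v, v.1 = x → (e v).1 = o) :
    ∫ t, p.eval t ∂(transitionMeasure hG x) = ∫ t, p.eval t ∂(transitionMeasure hH o) := by
  rw [integral_polynomial_transitionMeasure_eq_sum, integral_polynomial_transitionMeasure_eq_sum]
  refine Finset.sum_congr rfl fun k hk => ?_
  have hx : x ∈ G.ball x (p.natDegree + 1 : ℕ) := by
    rw [SimpleGraph.mem_ball, SimpleGraph.edist_self]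
    exact_mod_cast Nat.succ_pos _
  rw [adjOp_pow_delta_eq_of_ball_iso hG hH e he (Finset.mem_range.1 hk) ⟨x, hx⟩, he ⟨x, hx⟩ rfl]

theorem weaklyConverges_transitionMeasure {V : ℕ → Type*} {G : ∀ n, SimpleGraph (V n)}
    [∀ n, (G n).LocallyFinite] {x : ∀ n, V n} (hG : ∀ n, (G n).IsRegularOfDegree d)
    (hH : H.IsRegularOfDegree d) {o : W} (h : LocallyConverges G x H o) :
    WeaklyConverges (fun n => transitionMeasure (hG n) (x n)) (transitionMeasure hH o) := by
  have h1 := fun n => isProbabilityMeasure_transitionMeasure (hG n) (x n)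
  have h2 := isProbabilityMeasure_transitionMeasure hH o
  refine weaklyConverges_of_polynomial (fun n => ae_transitionMeasure_mem_Icc (hG n) (x n))
    (ae_transitionMeasure_mem_Icc hH o) fun p => ?_
  refine tendsto_const_nhds.congr' ?_
  filter_upwards [h (p.natDegree + 1)] with n ⟨e, he⟩
  exact (integral_polynomial_transitionMeasure_eq_of_ball_iso (hG n) hH p e he).symm

end LocalConvergence

/-! ### Weak convergence of Laplacian and transition measures -/

section Laplacian

variable {V : ℕ → Type*} {G : ∀ n, SimpleGraph (V n)} [∀ n, (G n).LocallyFinite] {x : ∀ n, V n}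
  {d : ℕ}

theorem weaklyConverges_laplacianMeasure {W : Type*} {H : SimpleGraph W} [H.LocallyFinite] {o : W}
    (hG : ∀ n, (G n).IsRegularOfDegree d) (hH : H.IsRegularOfDegree d) (hd : d ≠ 0)
    (h : WeaklyConverges (fun n => transitionMeasure (hG n) (x n)) (transitionMeasure hH o)) :
    WeaklyConverges (fun n => laplacianMeasure (hG n) (x n)) (laplacianMeasure hH o) := by
  intro f
  simp only [fun n => integral_laplacianMeasure (hG n) hd (x n) f.continuous,
    integral_laplacianMeasure hH hd o f.continuous]
  exact h (f.compContinuous ⟨fun t => d * (1 - t), by fun_prop⟩)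

/-- Inverts `t ↦ d (1 - t)`, which reduces the Laplacian statement to the one for the transition
operator. -/
theorem weaklyConverges_transitionMeasure_map (hG : ∀ n, (G n).IsRegularOfDegree d) (hd : d ≠ 0)
    {μ : Measure ℝ} (h : WeaklyConverges (fun n => laplacianMeasure (hG n) (x n)) μ) :
    WeaklyConverges (fun n => transitionMeasure (hG n) (x n))
      (μ.map fun t => 1 - t / d) := by
  intro f
  have hc : Continuous fun t : ℝ => 1 - t / d := by fun_prop
  have hd' : (d : ℝ) ≠ 0 := by exact_mod_cast hd
  rw [integral_map hc.aemeasurable f.continuous.aestronglyMeasurable]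
  refine (h (f.compContinuous ⟨_, hc⟩)).congr fun n => ?_
  rw [integral_laplacianMeasure (hG n) hd (x n) (BoundedContinuousFunction.continuous _)]
  refine integral_congr_ae (Eventually.of_forall fun t => ?_)
  change f (1 - d * (1 - t) / d) = f t
  congr 1
  field_simp
  ring

end Laplacian

/-! ### The zeta function of a finite vertex-transitive regular graph -/

section Zeta

variable {V : Type*} [Fintype V] {G : SimpleGraph V} [G.LocallyFinite] {q : ℕ}

theorem cycleSum_eq_integral (h : G.IsRegularOfDegree (q + 1)) (hG : IsVertexTransitive G)
    {a b c : ℝ} (hc : c = (1 - q) * a + b * q) (x : V) (k : ℕ) :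
    cycleSum G a b x (k + 1) =
      ∫ t, (dickson 1 (b * c) (k + 1)).eval ((b + c) * t) ∂(transitionMeasure h x)
        + ((q : ℝ) - 1) / 2 * (b ^ (k + 1) + (-b) ^ (k + 1)) := by
  classical
  have hq : ((q : ℝ) + 1) ≠ 0 := by positivity
  rw [cycleSum_eq G h hG a b _ rfl]
  -- This is `s (q + 1) = b + c`: it turns `s A` into `(b + c) P` and `s d - b` into `c`.
  have h1 : ((2 / ((q + 1 : ℕ) : ℝ) - 1) * a + b) * ((q + 1 : ℕ) : ℝ) = b + c := by
    rw [hc]; push_cast; field_simp; ring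
  have h2 := integral_polynomial_transitionMeasure_eq_adjMatrix h x
    ((dickson 1 (b * c) (k + 1)).comp (C (b + c) * X))
  simp only [eval_comp, eval_mul, eval_C, eval_X] at h2
  have h3 : aeval (((q + 1 : ℕ) : ℝ)⁻¹ • G.adjMatrix ℝ) (C (b + c) * X)
      = ((2 / ((q + 1 : ℕ) : ℝ) - 1) * a + b) • G.adjMatrix ℝ := by
    rw [← h1]
    simp only [map_mul, aeval_C, aeval_X, Algebra.algebraMap_eq_smul_one, smul_mul_assoc, one_mul,
      smul_smul]
    congr 1
    push_cast
    field_simp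
  rw [aeval_comp, h3] at h2
  rw [h2, h1, add_sub_cancel_left]
  push_cast
  congr! 1
  ring

theorem hasSum_zetaTerm (h : G.IsRegularOfDegree (q + 1)) (hG : IsVertexTransitive G)
    {a b c : ℝ} (hc : c = (1 - q) * a + b * q) (x : V) {u : ℂ} (hub : ‖u‖ * |b| < 1)
    (huc : ‖u‖ * |c| < 1) :
    HasSum (zetaTerm G a b x u)
      (-(((q : ℂ) - 1) / 2 * Complex.log (1 - b ^ 2 * u ^ 2)
        + ∫ t : ℝ, Complex.log (1 + b * c * u ^ 2 - (b + c) * u * t) ∂(transitionMeasure h x))) := by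
  have := isProbabilityMeasure_transitionMeasure h x
  have h1 := hasSum_integral_dickson_one_eval hub huc (ae_transitionMeasure_mem_Icc h x)
  have hbu : ‖(b : ℂ) * u‖ < 1 := by
    rw [norm_mul, mul_comm, Complex.norm_real]; exact hub
  -- The eigenvalues `± b` contribute `-log (1 - b ^ 2 u ^ 2)`, the source of the power in front of
  -- the exponential.
  have h2 := (hasSum_pow_add_pow (z := b) (w := -b) hbu (by rwa [neg_mul, norm_neg])).mul_left
    (((q : ℂ) - 1) / 2)
  have h3 : 1 - ((b : ℂ) + -b) * u + b * -b * u ^ 2 = 1 - b ^ 2 * u ^ 2 := by ring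
  rw [h3] at h2
  convert! h1.add h2 using 1
  · ext k
    rw [zetaTerm, cycleSum_eq_integral h hG hc]
    push_cast
    ring
  · ring

theorem zeta_inv_eq (h : G.IsRegularOfDegree (q + 1)) (hG : IsVertexTransitive G)
    {a b c : ℝ} (hc : c = (1 - q) * a + b * q) (x : V) {u : ℂ} (hub : ‖u‖ * |b| < 1)
    (huc : ‖u‖ * |c| < 1) :
    (zeta G a b x u)⁻¹ = (1 - (b : ℂ) ^ 2 * u ^ 2) ^ (((q : ℂ) - 1) / 2) *
      Complex.exp (∫ t : ℝ, Complex.log (1 + b * c * u ^ 2 - (b + c) * u * t)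
        ∂(transitionMeasure h x)) := by
  have h0 : 1 - (b : ℂ) ^ 2 * u ^ 2 ≠ 0 := fun h0 => by
    have h1 : ‖((b : ℂ) * u) ^ 2‖ = 1 := by
      rw [mul_pow, ← sub_eq_zero.1 h0, norm_one]
    rw [norm_pow, norm_mul, Complex.norm_real, mul_comm, Real.norm_eq_abs] at h1
    have h2 : (‖u‖ * |b|) ^ 2 < 1 := pow_lt_one₀ (by positivity) hub two_ne_zero
    linarith
  rw [zeta, (hasSum_zetaTerm h hG hc x hub huc).tsum_eq, ← Complex.exp_neg, neg_neg,
    Complex.exp_add, Complex.cpow_def_of_ne_zero h0, mul_comm (Complex.log _)]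

theorem tendsto_zeta_inv {V : ℕ → Type*} [∀ n, Fintype (V n)] {G : ∀ n, SimpleGraph (V n)}
    [∀ n, (G n).LocallyFinite] {x : ∀ n, V n} (h : ∀ n, (G n).IsRegularOfDegree (q + 1))
    (hG : ∀ n, IsVertexTransitive (G n)) {a b c : ℝ} (hc : c = (1 - q) * a + b * q)
    {u : ℂ} (hub : ‖u‖ * |b| < 1) (huc : ‖u‖ * |c| < 1) {μ : Measure ℝ} [IsProbabilityMeasure μ]
    (hμ : WeaklyConverges (fun n => transitionMeasure (h n) (x n)) μ) :
    Integrable (fun t : ℝ => Complex.log (1 + b * c * u ^ 2 - (b + c) * u * t)) μ ∧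
    Tendsto (fun n => (zeta (G n) a b (x n) u)⁻¹) atTop
      (𝓝 ((1 - (b : ℂ) ^ 2 * u ^ 2) ^ (((q : ℂ) - 1) / 2) *
        Complex.exp (∫ t : ℝ, Complex.log (1 + b * c * u ^ 2 - (b + c) * u * t) ∂μ))) := by
  have hp := fun n => isProbabilityMeasure_transitionMeasure (h n) (x n)
  obtain ⟨h1, h2⟩ := tendsto_integral_of_weaklyConverges hμ (by norm_num : (-1 : ℝ) ≤ 1)
    (fun n => ae_transitionMeasure_mem_Icc (h n) (x n))
    (f := fun t : ℝ => Complex.log (1 + b * c * u ^ 2 - (b + c) * u * t))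
    (ContinuousOn.clog (by fun_prop) fun t ht => quadratic_mem_slitPlane hub huc (abs_le.2 ht))
  refine ⟨h1, ?_⟩
  simp only [fun n => zeta_inv_eq (h n) (hG n) hc (x n) hub huc]
  exact ((Complex.continuous_exp.tendsto _).comp h2).const_mul _

end Zeta

end GroverZeta

/-! ### The limit theorem -/

theorem theorem8
    {V : ℕ → Type*} [∀ n, Fintype (V n)]
    (G : ∀ n, SimpleGraph (V n)) [∀ n, (G n).LocallyFinite] (x₀ : ∀ n, V n)
    (q : ℕ) (hreg : ∀ n, (G n).IsRegularOfDegree (q + 1))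
    (htrans : ∀ n, GroverZeta.IsVertexTransitive (G n))
    (hcard : Tendsto (fun n => Fintype.card (V n)) atTop atTop)
    (a b : ℝ) (ha : a ∈ Set.Icc (0 : ℝ) 1)
    (η σ : ℝ) (hη : η = (1 - q) * a + b * (q + 1)) (hσ : σ = b * ((1 - q) * a + b * q))
    (u : ℂ) (hub : ‖u‖ * |b| < 1) (huq : ‖u‖ * |(1 - q) * a + b * q| < 1) :
    -- the series that defines the zeta functions converges
    (∀ n, Summable (GroverZeta.zetaTerm (G n) a b (x₀ n) u)) ∧
    -- limiting spectral measure of the transition operators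
    (∀ μP : Measure ℝ, IsProbabilityMeasure μP →
      GroverZeta.WeaklyConverges
        (fun n => GroverZeta.transitionMeasure (hreg n) (x₀ n)) μP →
      Integrable (fun t : ℝ => Complex.log ((1 + σ * u ^ 2) - η * u * t)) μP ∧
      Tendsto (fun n => (GroverZeta.zeta (G n) a b (x₀ n) u)⁻¹) atTop
        (𝓝 ((1 - b ^ 2 * u ^ 2) ^ (((q : ℂ) - 1) / 2) *
          Complex.exp (∫ t : ℝ, Complex.log ((1 + σ * u ^ 2) - η * u * t) ∂μP)))) ∧
    -- limiting spectral measure of the Laplacians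
    (∀ μΔ : Measure ℝ, IsProbabilityMeasure μΔ →
      GroverZeta.WeaklyConverges
        (fun n => GroverZeta.laplacianMeasure (hreg n) (x₀ n)) μΔ →
      Integrable
        (fun t : ℝ => Complex.log ((1 - η * u + σ * u ^ 2) + η * u / (q + 1) * t)) μΔ ∧
      Tendsto (fun n => (GroverZeta.zeta (G n) a b (x₀ n) u)⁻¹) atTop
        (𝓝 ((1 - b ^ 2 * u ^ 2) ^ (((q : ℂ) - 1) / 2) *
          Complex.exp
            (∫ t : ℝ, Complex.log ((1 - η * u + σ * u ^ 2) + η * u / (q + 1) * t) ∂μΔ)))) ∧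
    -- if the graphs converge locally, these are the spectral measures of the limit graph
    (∀ {W : Type*} (H : SimpleGraph W) [H.LocallyFinite] (o : W)
      (hH : H.IsRegularOfDegree (q + 1)), GroverZeta.LocallyConverges G x₀ H o →
      (IsProbabilityMeasure (GroverZeta.transitionMeasure hH o) ∧
        GroverZeta.WeaklyConverges
          (fun n => GroverZeta.transitionMeasure (hreg n) (x₀ n))
          (GroverZeta.transitionMeasure hH o)) ∧
      (IsProbabilityMeasure (GroverZeta.laplacianMeasure hH o) ∧
        GroverZeta.WeaklyConverges
          (fun n => GroverZeta.laplacianMeasure (hreg n) (x₀ n))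
          (GroverZeta.laplacianMeasure hH o))) := by
  obtain ⟨c, hc⟩ : ∃ c : ℝ, c = (1 - q) * a + b * q := ⟨_, rfl⟩
  have hη' : (η : ℂ) = b + c := by rw [hη, hc]; push_cast; ring
  have hσ' : (σ : ℂ) = b * c := by rw [hσ, hc]; push_cast; ring
  rw [← hc] at huq
  have hd : q + 1 ≠ 0 := q.succ_ne_zero
  have hq : (q : ℂ) + 1 ≠ 0 := by exact_mod_cast hd
  simp only [hη', hσ']
  refine ⟨fun n => (GroverZeta.hasSum_zetaTerm (hreg n) (htrans n) hc (x₀ n) hub huq).summable,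
    fun μ hμ h => GroverZeta.tendsto_zeta_inv hreg htrans hc hub huq h, fun μ hμ h => ?_,
    fun H _ o hH h => ?_⟩
  · have hm : Measurable fun t : ℝ => 1 - t / ((q + 1 : ℕ) : ℝ) := by fun_prop
    have := Measure.isProbabilityMeasure_map (μ := μ) hm.aemeasurable
    obtain ⟨h1, h2⟩ := GroverZeta.tendsto_zeta_inv hreg htrans hc hub huq
      (GroverZeta.weaklyConverges_transitionMeasure_map hreg hd h)
    -- Substituting `1 - t / (q + 1)` for the eigenvalue of `P` gives the Laplacian integrand, so
    -- the pushforward integral is the required one.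
    have h3 : ∀ t : ℝ, (1 + b * c * u ^ 2 - (b + c) * u * (1 - t / ((q + 1 : ℕ) : ℝ) : ℝ) : ℂ)
        = 1 - (b + c) * u + b * c * u ^ 2 + (b + c) * u / (q + 1) * t := fun t => by
      push_cast
      field_simp
      ring
    have h4 := integral_map hm.aemeasurable h1.aestronglyMeasurable
    have h5 := h1.comp_measurable hm
    simp only [Function.comp_def, h3] at h4 h5
    exact ⟨h5, h4 ▸ h2⟩
  · have h1 := GroverZeta.weaklyConverges_transitionMeasure hreg hH h
    exact ⟨⟨GroverZeta.isProbabilityMeasure_transitionMeasure hH o, h1⟩,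
      GroverZeta.isProbabilityMeasure_laplacianMeasure hH hd o,
      GroverZeta.weaklyConverges_laplacianMeasure hreg hH hd h1⟩
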